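/- Let $\Gamma$ be a countably infinite discrete group with identity $\mathbf 1$, and let $S\subset\Gamma$ be a finite set. We identify $k$ with $\{0,\dots,k-1\}$. **Spaces and patterns.** A $\Gamma$-space is a topological space with a continuous action of $\Gamma$; it is free if all stabilizers are trivial. The space $2^\Gamma$ carries the product topology and the action $(\gamma\cdot x)(\delta)=x(\delta\gamma)$, and $\mathrm{Free}(2^\Gamma)$ is the subspace of points with trivial stabilizer. A space is zero-dimensional if it has a base of clopen sets. For $k\ge 1$, a $k$-pattern is a map $p\colon \mathrm{dom}(p)\to k$ with $\mathrm{dom}(p)\subset\Gamma$ finite. It occurs in a coloring $f\colon X\to k$ of a $\Gamma$-space $X$ if there is $x\in X$ with $f(\gamma\cdot x)=p(\gamma)$ for all $\gamma\in\mathrm{dom}(p)$. **Labeled graphs.** An $S$-labeled graph is a simple undirected graph with a labeling $\lambda$ that assigns to each ordered pair $(x,y)$ of adjacent vertices an element $\lambda(x,y)\in S\cup S^{-1}$ such that $\lambda(y,x)=\lambda(x,y)^{-1}$. A homomorphism of $S$-labeled graphs is a map of the vertex sets that preserves adjacency and the labels of adjacent pairs. The Cayley graph $G(\Gamma,S)$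 has vertex set $\Gamma$, with distinct $x,y$ adjacent if and only if $yx^{-1}\in S\cup S^{-1}$, and $\lambda(x,y)=yx^{-1}$; $G(F,S)$ is its subgraph induced by $F\subseteq\Gamma$. A $k$-pattern $p$ is $S$-connected if $G(\mathrm{dom}(p),S)$ is connected (and nonempty). It occurs in a coloring $f\colon V(G)\to k$ of an $S$-labeled graph $G$ if there is a homomorphism $\phi\colon G(\mathrm{dom}(p),S)\to G$ with $f\circ\phi=p$. A coloring (of a $\Gamma$-space or of an $S$-labeled graph) is $\mathscr P$-avoiding if no $p\in\mathscr P$ occurs in it. **The graphs $H_{D,n}$.** For a finite set $D\subset\Gamma$ with $S\cup S^{-1}\cup\{\mathbf 1\}\subseteq D$ and $n\ge 1$, let $H_{D,n}$ be the finite $S$-labeled graph whose vertices are the injections $D\to n$, where for distinct $q,q'$ there is an edge labeled $\sigma\in S\cup S^{-1}$ from $q$ to $q'$ if and only if $q(\delta)=q'(\delta')$ for all $\delta,\delta'\in D$ with $\delta=\delta'\sigma$ (such a $\sigma$ is unique if it exists). **The families.** Let $\log^* n$ be the number of times the binary logarithm must be applied to $n$ before the result becomes at most $1$. Call $(F_i,n_i)_{i\ge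 1}$ admissible if $S\cup S^{-1}\cup\{\mathbf 1\}\subseteq F_1\subsetneq F_2\subsetneq\cdots$ are finite subsets of $\Gamma$ with $\bigcup_i F_i=\Gamma$, the $n_i\ge 1$ are integers with $n_i\ge |F_i|^{2\log^* n_i}$, and the sets $D_i:=F_i^{\log^* n_i}$ satisfy $S\cup S^{-1}\cup\{\mathbf 1\}\subseteq D_i$ (which is automatic if $n_i\ge 2$). **Theorem.** Admissible sequences exist. Let $(F_i,n_i)_{i\ge1}$ be any admissible sequence, and let $\mathscr H=(H_{D_i,n_i})_{i\ge 1}$. Then for every $k\ge 1$ and every finite set $\mathscr P$ of $S$-connected $k$-patterns the following statements are equivalent: 1. There is a continuous $\mathscr P$-avoiding $k$-coloring of $\mathrm{Free}(2^\Gamma)$. 2. Every free zero-dimensional Polish $\Gamma$-space admits a continuous $\mathscr P$-avoiding $k$-coloring. 3. There is an $i$ such that $H_{D_i,n_i}$ admits a $\mathscr P$-avoiding $k$-coloring. 4. For all but finitely many $i$, the graph $H_{D_i,n_i}$ admits a $\mathscr P$-avoiding $k$-coloring. -/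

import Mathlib

open scoped Pointwise

universe u v w

namespace ContinuousColoring



section Spaces

/-- A topological space is zero-dimensional if its clopen subsets form a base of the topology. -/
def ZeroDimensional (X : Type v) [TopologicalSpace X] : Prop :=
  TopologicalSpace.IsTopologicalBasis {U : Set X | IsClopen U}

/-- An action is free if all stabilizers are trivial. -/
def FreeAction (Γ : Type u) (X : Type v) [Group Γ] [MulAction Γ X] : Prop :=
  ∀ x : X, MulAction.stabilizer Γ x = ⊥

/-- The free part of a `Γ`-space: the invariant set of points with trivial stabilizer. As a type it
carries the subspace topology and the induced action. -/
def FreePart (Γ : Type u) (X : Type v) [Group Γ] [MulAction Γ X] : SubMulAction Γ X where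
  carrier := {x | MulAction.stabilizer Γ x = ⊥}
  smul_mem' := by
    intro c x hx
    have hx' : MulAction.stabilizer Γ x = ⊥ := hx
    change MulAction.stabilizer Γ (c • x) = ⊥
    rw [MulAction.stabilizer_smul_eq_stabilizer_map_conj, hx', Subgroup.map_bot]

/-- The Bernoulli shift `k^Γ`. -/
def Shift (Γ : Type u) (k : ℕ) : Type u := Γ → Fin k

/-- The product topology on `k^Γ`, where `k` is discrete. -/
instance Shift.instTopologicalSpace (Γ : Type u) (k : ℕ) : TopologicalSpace (Shift Γ k) :=
  inferInstanceAs (TopologicalSpace (Γ → Fin k))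

/-- The shift action `(γ • x) δ = x (δ γ)`. -/
instance Shift.instMulAction (Γ : Type u) [Group Γ] (k : ℕ) : MulAction Γ (Shift Γ k) where
  smul γ x := fun δ => x (δ * γ)
  one_smul x := funext fun δ => congrArg x (mul_one δ)
  mul_smul γ γ' x := funext fun δ => congrArg x (mul_assoc δ γ γ').symm

end Spaces

section Patterns

/-- A `k`-pattern: a partial map from `Γ` to `k` with finite domain. -/
structure Pattern (Γ : Type u) (k : ℕ) where
  /-- the domain -/
  dom : Finset Γ
  /-- the values -/
  val : dom → Fin k

/-- The pattern `p` occurs in the coloring `f` of a space with an action of `Γ`. -/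
def Pattern.Occurs {Γ : Type u} {k : ℕ} {X : Type v} [Group Γ] [MulAction Γ X]
    (p : Pattern Γ k) (f : X → Fin k) : Prop :=
  ∃ x : X, ∀ γ : p.dom, f ((γ : Γ) • x) = p.val γ

/-- The space `X` admits a continuous coloring with `k` colors that avoids all patterns in `P`. -/
def HasContinuousAvoidingColoring {Γ : Type u} {k : ℕ} (P : Set (Pattern Γ k)) (X : Type v)
    [TopologicalSpace X] [Group Γ] [MulAction Γ X] : Prop :=
  ∃ f : X → Fin k, Continuous f ∧ ∀ p ∈ P, ¬ p.Occurs f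

end Patterns

section LabeledGraphs

variable {Γ : Type u} [Group Γ] [DecidableEq Γ]

/-- An `S`-labeled graph on the vertex set `V`. Only the labels of ordered pairs of adjacent
vertices are meaningful. -/
structure LabeledGraph (S : Finset Γ) (V : Type v) where
  /-- the underlying simple graph -/
  graph : SimpleGraph V
  /-- the labeling map -/
  label : V → V → Γ
  label_mem : ∀ x y, graph.Adj x y → label x y ∈ S ∪ S⁻¹
  label_symm : ∀ x y, graph.Adj x y → label y x = (label x y)⁻¹

/-- The subgraph induced by a set of vertices. -/
def LabeledGraph.induce {S : Finset Γ} {V : Type v} (G : LabeledGraph S V) (U : Set V) :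
    LabeledGraph S U where
  graph := G.graph.induce U
  label x y := G.label x y
  label_mem x y h := G.label_mem x y h
  label_symm x y h := G.label_symm x y h

/-- Homomorphisms of `S`-labeled graphs. -/
def LabeledGraph.IsHom {S : Finset Γ} {V : Type v} {W : Type w} (G : LabeledGraph S V)
    (H : LabeledGraph S W) (φ : V → W) : Prop :=
  ∀ x y, G.graph.Adj x y →
    H.graph.Adj (φ x) (φ y) ∧ H.label (φ x) (φ y) = G.label x y

theorem inv_mem_union_inv {S : Finset Γ} {σ : Γ} (h : σ ∈ S ∪ S⁻¹) : σ⁻¹ ∈ S ∪ S⁻¹ := by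
  simp only [Finset.mem_union, Finset.mem_inv', inv_inv] at h ⊢
  exact h.symm

/-- The Cayley graph of `Γ`: an edge from `x` to `σ x` is labeled `σ`. -/
def cayleyGraph (S : Finset Γ) : LabeledGraph S Γ where
  graph :=
    { Adj := fun x y => x ≠ y ∧ ∃ σ ∈ S ∪ S⁻¹, y = σ * x
      symm := ⟨by
        rintro x y ⟨hne, σ, hσ, rfl⟩
        exact ⟨hne.symm, σ⁻¹, inv_mem_union_inv hσ, by simp⟩⟩
      loopless := ⟨fun x h => h.1 rfl⟩ }
  label x y := y * x⁻¹
  label_mem := by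
    rintro x y ⟨-, σ, hσ, rfl⟩
    simpa using hσ
  label_symm := by
    intro x y _
    simp

/-- A pattern is `S`-connected if its domain induces a connected (in particular nonempty) subgraph
of the Cayley graph. -/
def Pattern.SConnected {k : ℕ} (S : Finset Γ) (p : Pattern Γ k) : Prop :=
  ((cayleyGraph S).induce (p.dom : Set Γ)).graph.Connected

/-- The pattern `p` occurs in the coloring `f` of an `S`-labeled graph. -/
def Pattern.OccursIn {k : ℕ} {S : Finset Γ} {V : Type v} (p : Pattern Γ k)
    (G : LabeledGraph S V) (f : V → Fin k) : Prop :=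
  ∃ φ : p.dom → V, ((cayleyGraph S).induce (p.dom : Set Γ)).IsHom G φ ∧
    ∀ γ : p.dom, f (φ γ) = p.val γ

/-- The `S`-labeled graph `G` admits a coloring with `k` colors that avoids all patterns in `P`. -/
def LabeledGraph.HasAvoidingColoring {k : ℕ} {S : Finset Γ} {V : Type v}
    (G : LabeledGraph S V) (P : Set (Pattern Γ k)) : Prop :=
  ∃ f : V → Fin k, ∀ p ∈ P, ¬ p.OccursIn G f

end LabeledGraphs

section Tiles

variable {Γ : Type u} [Group Γ]

/-- The injections `q, q' : D → n` are `σ`-compatible. -/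
def Compatible {D : Finset Γ} {n : ℕ} (σ : Γ) (q q' : D ↪ Fin n) : Prop :=
  ∀ δ δ' : D, (δ : Γ) = δ' * σ → q δ = q' δ'

theorem Compatible.inv {D : Finset Γ} {n : ℕ} {σ : Γ} {q q' : D ↪ Fin n}
    (h : Compatible σ q q') : Compatible σ⁻¹ q' q := by
  intro δ δ' hδ
  exact (h δ' δ (by simp [hδ])).symm

variable [DecidableEq Γ]

theorem Compatible.unique {S D : Finset Γ} (hD : S ∪ S⁻¹ ∪ {1} ⊆ D) {n : ℕ} {σ τ : Γ}
    {q q' : D ↪ Fin n} (hσ : σ ∈ S ∪ S⁻¹) (hτ : τ ∈ S ∪ S⁻¹)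
    (h : Compatible σ q q') (h' : Compatible τ q q') : σ = τ := by
  have h1 : (1 : Γ) ∈ D := hD (by simp)
  have e := h ⟨σ, hD (Finset.mem_union_left _ hσ)⟩ ⟨1, h1⟩ (by simp)
  have e' := h' ⟨τ, hD (Finset.mem_union_left _ hτ)⟩ ⟨1, h1⟩ (by simp)
  exact congrArg Subtype.val (q.injective (e.trans e'.symm))

open Classical in
/-- The label of the ordered pair `(q, q')` in `H_{D,n}`: the element `σ` of `S ∪ S⁻¹` such that
`q` and `q'` are `σ`-compatible, if there is one (it is then unique), and a junk value otherwise. -/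
noncomputable def tileLabel (S : Finset Γ) {D : Finset Γ} {n : ℕ} (q q' : D ↪ Fin n) : Γ :=
  if h : ∃ σ ∈ S ∪ S⁻¹, Compatible σ q q' then h.choose else 1

theorem tileLabel_eq {S D : Finset Γ} (hD : S ∪ S⁻¹ ∪ {1} ⊆ D) {n : ℕ} {σ : Γ}
    {q q' : D ↪ Fin n} (hσ : σ ∈ S ∪ S⁻¹) (h : Compatible σ q q') :
    tileLabel S q q' = σ := by
  have hex : ∃ σ ∈ S ∪ S⁻¹, Compatible σ q q' := ⟨σ, hσ, h⟩
  rw [tileLabel, dif_pos hex]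
  exact Compatible.unique hD hex.choose_spec.1 hσ hex.choose_spec.2 h

/-- The finite `S`-labeled graph `H_{D,n}`. Its vertices are the injections `D → n`, and there is an
edge labeled `σ ∈ S ∪ S⁻¹` from `q` to `q'` if and only if they are `σ`-compatible. The graph has no
loops: the condition `q ≠ q'` discards only the label `1`, for which compatibility is equality. -/
noncomputable def tileGraph (S D : Finset Γ) (n : ℕ) (hD : S ∪ S⁻¹ ∪ {1} ⊆ D) :
    LabeledGraph S (D ↪ Fin n) where
  graph :=
    { Adj := fun q q' => q ≠ q' ∧ ∃ σ ∈ S ∪ S⁻¹, Compatible σ q q'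
      symm := ⟨by
        rintro q q' ⟨hne, σ, hσ, h⟩
        exact ⟨hne.symm, σ⁻¹, inv_mem_union_inv hσ, h.inv⟩⟩
      loopless := ⟨fun q h => h.1 rfl⟩ }
  label := tileLabel S
  label_mem := by
    rintro q q' ⟨-, σ, hσ, h⟩
    rw [tileLabel_eq hD hσ h]
    exact hσ
  label_symm := by
    rintro q q' ⟨-, σ, hσ, h⟩
    rw [tileLabel_eq hD hσ h, tileLabel_eq hD (inv_mem_union_inv hσ) h.inv]

/-- The iterated (binary) logarithm: the number of times the logarithm has to be applied to `n`
before the result becomes at most `1`. -/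
noncomputable def logStar (n : ℕ) : ℕ :=
  sInf {t : ℕ | (Real.logb 2)^[t] (n : ℝ) ≤ 1}

/-- The sequences of parameters that give rise to the families of graphs `H_{D_i, n_i}`, where
`D_i = F_i ^ (log* n_i)`. -/
structure IsTileSequence (S : Finset Γ) (F : ℕ → Finset Γ) (n : ℕ → ℕ) : Prop where
  base : S ∪ S⁻¹ ∪ {1} ⊆ F 0
  strictMono : StrictMono F
  exhausts : ∀ γ : Γ, ∃ i, γ ∈ F i
  one_le : ∀ i, 1 ≤ n i
  card_pow_le : ∀ i, (F i).card ^ (2 * logStar (n i)) ≤ n i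
  /-- The standing condition on `D` under which the graph `H_{D,n}` is defined. It is automatic if
  `n i ≥ 2`, since then `D_i` contains `F_i`. -/
  subset : ∀ i, S ∪ S⁻¹ ∪ {1} ⊆ F i ^ logStar (n i)

end Tiles

end ContinuousColoring

namespace ContinuousColoring

open Topology Filter

/-! ### Locally constant maps and greedy constructions on free zero-dimensional spaces -/

section LocallyConstant

variable {Γ : Type u} [Group Γ] {X : Type v} [TopologicalSpace X]

/-! The implications form the cycle 1 → 2 → 4 → 3 → 1, where 4 → 3 only uses that ℕ is infinite.

3 → 1. Since `D.card ^ 2 ≤ n`, a greedy argument colors the free part continuously with `n` colors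
so that each `D • x` receives distinct colors. Reading the colors on `D • x` sends `x` to an
injection `D ↪ Fin n`. Along an orbit these injections are compatible, so a coloring of `H_{D,n}`
pulls back.

1 → 2. There need be no obvious equivariant map from `X` to the free part, but an approximation
suffices. For each period `γ ≠ 1` there is a finite witness set `T`, independent of `X`, such that
finitely many periods can be broken at once by a continuous map `X → Bool` with witnesses in these
`T`. Breaking all periods with these witnesses defines a compact subshift of the free part. A
coloring extends from it to the whole shift, and by compactness the extension still avoids the
patterns where only the first `r` periods are broken; the orbit maps of `X` land there. The
combinatorial core is `exists_breaking_step`: points of a sparse clopen set `B'` own `2l` cells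
each, and choose bits there so that no relevant conjugate of `γ` looks like a period. Each
constraint involves at most two choices and `l` can be large, so a greedy choice
(`exists_assignment`) succeeds.

2 → 4. The space `ColoringSpace Γ` of proper `6`-colorings for all translations by `γ ≠ 1` is
compact and free, so its continuous coloring reads a finite window. From an injection `D ↪ Fin n`,
`log* n` rounds of Cole–Vishkin reduction compute the `6`-colors in that window, looking only at
points `γ ^ a * u` with `a ≤ log* n`; this is why `D = F ^ log* n`. Since patterns are connected,
the injections in an occurrence glue to one partial coloring of `Γ`, which extends to a point of the
space, where the pattern would then occur. -/

theorem isLocallyConstant_pi {ι : Type*} [Finite ι] {α : ι → Type*} {f : X → ∀ i, α i}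
    (h : ∀ i, IsLocallyConstant fun x => f x i) : IsLocallyConstant f := by
  refine (IsLocallyConstant.iff_eventually_eq f).2 fun x => ?_
  have := eventually_all.2 fun i => (IsLocallyConstant.iff_eventually_eq _).1 (h i) x
  filter_upwards [this] with y hy using funext hy

theorem isLocallyConstant_forall {ι : Type*} [Finite ι] {p : X → ι → Prop}
    (h : ∀ i, IsLocallyConstant fun x => p x i) : IsLocallyConstant fun x => ∀ i, p x i :=
  (isLocallyConstant_pi h).comp fun q => ∀ i, q i

theorem isLocallyConstant_exists {ι : Type*} [Finite ι] {p : X → ι → Prop}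
    (h : ∀ i, IsLocallyConstant fun x => p x i) : IsLocallyConstant fun x => ∃ i, p x i :=
  (isLocallyConstant_pi h).comp fun q => ∃ i, q i

theorem isLocallyConstant_exists_mem {ι : Type*} (s : Finset ι) {p : X → ι → Prop}
    (h : ∀ i, IsLocallyConstant fun x => p x i) : IsLocallyConstant fun x => ∃ i ∈ s, p x i := by
  have := isLocallyConstant_exists (ι := s) (p := fun x i => p x i) fun i => h i
  simpa only [Subtype.exists, exists_prop] using this

theorem isLocallyConstant_mem {U : Set X} (h : IsClopen U) : IsLocallyConstant fun x => x ∈ U := by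
  refine (IsLocallyConstant.iff_eventually_eq _).2 fun x => ?_
  by_cases hx : x ∈ U
  · filter_upwards [h.isOpen.mem_nhds hx] with y hy using by simp [hx, hy]
  · filter_upwards [h.compl.isOpen.mem_nhds hx] with y hy
    simp only [eq_iff_iff]
    exact ⟨fun h => absurd h hy, fun h => absurd h hx⟩

variable [MulAction Γ X] [ContinuousConstSMul Γ X]

theorem isLocallyConstant_const_smul {α : Type*} {f : X → α} (hf : IsLocallyConstant f) (γ : Γ) :
    IsLocallyConstant fun x => f (γ • x) :=
  hf.comp_continuous (continuous_const_smul γ)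

theorem isLocallyConstant_smul {α : Type*} {f : X → α} {a : X → Γ} (ha : IsLocallyConstant a)
    (hf : IsLocallyConstant f) : IsLocallyConstant fun x => f (a x • x) := by
  refine (IsLocallyConstant.iff_eventually_eq _).2 fun x => ?_
  filter_upwards [(IsLocallyConstant.iff_eventually_eq _).1 ha x,
    (IsLocallyConstant.iff_eventually_eq _).1 (isLocallyConstant_const_smul hf (a x)) x]
    with y h1 h2
  rw [h1, h2]

/-- Greedy definition of a locally constant map: the value at `x` may depend on the values at those
points `γ • x`, with `γ` in a finite set, that have smaller rank. -/
theorem exists_greedy {V : Type*} (N : Finset Γ) {ρ : X → ℕ} (hρ : IsLocallyConstant ρ)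
    {Φ : X → (N → Option V) → V} (hΦ : IsLocallyConstant Φ) :
    ∃ c : X → V, IsLocallyConstant c ∧ ∀ x, c x = Φ x fun γ =>
      if ρ ((γ : Γ) • x) < ρ x then some (c ((γ : Γ) • x)) else none := by
  classical
  let c : X → V := (measure ρ).wf.fix fun x ih => Φ x fun γ =>
    if h : ρ ((γ : Γ) • x) < ρ x then some (ih ((γ : Γ) • x) h) else none
  have hc : ∀ x, c x = Φ x fun γ =>
      if ρ ((γ : Γ) • x) < ρ x then some (c ((γ : Γ) • x)) else none := by
    intro x
    have h := (measure ρ).wf.fix_eq (C := fun _ => V) (fun x ih => Φ x fun γ =>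
      if h : ρ ((γ : Γ) • x) < ρ x then some (ih ((γ : Γ) • x) h) else none) x
    exact h
  refine ⟨c, (IsLocallyConstant.iff_eventually_eq _).2 fun x => ?_, hc⟩
  induction hn : ρ x using Nat.strong_induction_on generalizing x with
  | _ n ih =>
    have h1 : ∀ᶠ y in 𝓝 x, ∀ γ : N, ρ ((γ : Γ) • y) = ρ ((γ : Γ) • x) := eventually_all.2 fun γ =>
      (IsLocallyConstant.iff_eventually_eq _).1 (isLocallyConstant_const_smul hρ (γ : Γ)) x
    have h2 : ∀ᶠ y in 𝓝 x, ∀ γ : N, ρ ((γ : Γ) • x) < ρ x → c ((γ : Γ) • y) = c ((γ : Γ) • x) := by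
      refine eventually_all.2 fun γ => ?_
      by_cases h : ρ ((γ : Γ) • x) < ρ x
      · have := ih _ (hn ▸ h) ((γ : Γ) • x) rfl
        filter_upwards [(continuous_const_smul (γ : Γ)).continuousAt.eventually this] with y hy _
          using hy
      · exact Eventually.of_forall fun y h' => absurd h' h
    filter_upwards [h1, h2, (IsLocallyConstant.iff_eventually_eq _).1 hρ x,
      (IsLocallyConstant.iff_eventually_eq _).1 hΦ x] with y h1 h2 h3 h4
    rw [hc y, hc x, h4]
    congr 1
    funext γ
    rw [h1, h3]
    split_ifs with h
    · rw [h2 γ h]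
    · rfl

theorem FreeAction.eq_one {Y : Type*} [MulAction Γ Y] (h : FreeAction Γ Y) {γ : Γ} {x : Y}
    (hx : γ • x = x) : γ = 1 := by
  have : γ ∈ MulAction.stabilizer Γ x := hx
  rwa [h x, Subgroup.mem_bot] at this

/-- On a free zero-dimensional space the points can be ranked, in a locally constant way, so that
nearby points of an orbit get distinct ranks. -/
theorem exists_rank [SecondCountableTopology X] [T2Space X] (hX : ZeroDimensional X)
    (hfree : FreeAction Γ X) (R : Finset Γ) :
    ∃ ρ : X → ℕ, IsLocallyConstant ρ ∧ ∀ x, ∀ γ ∈ R, γ ≠ 1 → ρ (γ • x) ≠ ρ x := by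
  classical
  -- Freeness and the Hausdorff property separate a neighborhood of `x` from its finitely many
  -- nontrivial `R`-translates. The rank will be the index of the first member of a countable cover
  -- by such sets, so points related by `R` cannot share it.
  have key : ∀ x : X, ∃ U : Set X, IsClopen U ∧ x ∈ U ∧ ∀ γ ∈ R, γ ≠ 1 → ∀ y ∈ U, γ • y ∉ U := by
    intro x
    have h : ∀ᶠ p : X × X in 𝓝 x ×ˢ 𝓝 x, ∀ γ : R, (γ : Γ) ≠ 1 → (γ : Γ) • p.1 ≠ p.2 := by
      refine eventually_all.2 fun γ => ?_
      by_cases hγ : (γ : Γ) = 1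
      · exact Eventually.of_forall fun _ h => absurd hγ h
      have hne : (γ : Γ) • x ≠ x := fun h => hγ (hfree.eq_one h)
      have ho : IsOpen {p : X × X | (γ : Γ) • p.1 ≠ p.2} :=
        isOpen_ne_fun ((continuous_const_smul (γ : Γ)).comp continuous_fst) continuous_snd
      rw [← nhds_prod_eq]
      filter_upwards [ho.mem_nhds (show (x, x) ∈ _ from hne)] with p hp _ using hp
    obtain ⟨V, hV, hV'⟩ := eventually_prod_self_iff'.1 h
    obtain ⟨U, hU, hxU, hUV⟩ := hX.mem_nhds_iff.1 hV
    exact ⟨U, hU, hxU, fun γ hγ h1 y hy hy' => hV' y (hUV hy) _ (hUV hy') ⟨γ, hγ⟩ h1 rfl⟩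
  choose U hU hxU hUR using key
  obtain ⟨s, hs, hcover⟩ := TopologicalSpace.countable_cover_nhds
    fun x => (hU x).isOpen.mem_nhds (hxU x)
  have := hs.to_subtype
  obtain ⟨e, he⟩ := exists_injective_nat s
  have hex : ∀ x, ∃ n, ∃ z : s, e z = n ∧ x ∈ U z := by
    intro x
    have : x ∈ ⋃ z ∈ s, U z := hcover ▸ Set.mem_univ x
    simp only [Set.mem_iUnion] at this
    obtain ⟨z, hz, hx⟩ := this
    exact ⟨_, ⟨z, hz⟩, rfl, hx⟩
  have hP : ∀ n, IsLocallyConstant fun x => ∃ z : s, e z = n ∧ x ∈ U z := by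
    intro n
    by_cases hn : ∃ z, e z = n
    · obtain ⟨z, rfl⟩ := hn
      convert isLocallyConstant_mem (hU z) using 3 with x
      exact ⟨fun ⟨z', h, hx⟩ => he h ▸ hx, fun hx => ⟨z, rfl, hx⟩⟩
    · convert IsLocallyConstant.const False using 3 with x
      exact ⟨fun ⟨z, h, _⟩ => hn ⟨z, h⟩, False.elim⟩
  refine ⟨fun x => Nat.find (hex x), (IsLocallyConstant.iff_eventually_eq _).2 fun x => ?_, ?_⟩
  · have h : ∀ᶠ y in 𝓝 x, ∀ m : Fin (Nat.find (hex x) + 1),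
        (∃ z : s, e z = m ∧ y ∈ U z) = (∃ z : s, e z = m ∧ x ∈ U z) := eventually_all.2 fun m =>
      (IsLocallyConstant.iff_eventually_eq _).1 (hP m) x
    filter_upwards [h] with y hy
    rw [Nat.find_eq_iff]
    refine ⟨?_, fun m hm => ?_⟩
    · have := hy ⟨Nat.find (hex x), Nat.lt_succ_self _⟩
      simp only at this
      rw [this]
      exact Nat.find_spec (hex x)
    · have := hy ⟨m, by omega⟩
      simp only at this
      rw [this]
      exact Nat.find_min (hex x) hm
  · intro x γ hγ h1 heq
    obtain ⟨z, hz, hxz⟩ := Nat.find_spec (hex x)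
    obtain ⟨z', hz', hxz'⟩ := Nat.find_spec (hex (γ • x))
    have : z' = z := he (by rw [hz, hz']; exact heq)
    subst this
    exact hUR z' γ hγ h1 x hxz hxz'

/-- Continuous greedy coloring: a free zero-dimensional space has a proper `n`-coloring with respect
to translations from a finite symmetric set with fewer than `n` nontrivial elements. -/
theorem exists_proper_coloring [SecondCountableTopology X] [T2Space X] (hX : ZeroDimensional X)
    (hfree : FreeAction Γ X) [DecidableEq Γ] (R : Finset Γ) (hR : ∀ γ ∈ R, γ⁻¹ ∈ R) (n : ℕ)
    (hn : (R.erase 1).card < n) :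
    ∃ c : X → Fin n, IsLocallyConstant c ∧ ∀ x, ∀ γ ∈ R, γ ≠ 1 → c (γ • x) ≠ c x := by
  classical
  obtain ⟨ρ, hρ, hρR⟩ := exists_rank hX hfree R
  have : Nonempty (Fin n) := ⟨⟨0, by omega⟩⟩
  have hfresh : ∀ o : R.erase 1 → Option (Fin n), ∃ v : Fin n, ∀ γ, o γ ≠ some v := by
    intro o
    by_contra! h
    choose g hg using h
    have hinj : Function.Injective g := fun v w hvw => by
      have := (hg v).symm.trans (hvw ▸ hg w)
      simpa using this
    have := Fintype.card_le_of_injective g hinj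
    simp only [Fintype.card_fin, Fintype.card_coe] at this
    omega
  choose Φ hΦ using hfresh
  obtain ⟨c, hc, hcx⟩ := exists_greedy (R.erase 1) hρ (Φ := fun _ => Φ) (IsLocallyConstant.const _)
  have key : ∀ x, ∀ γ ∈ R, γ ≠ 1 → ρ (γ • x) < ρ x → c (γ • x) ≠ c x := by
    intro x γ hγ h1 hlt heq
    have := hΦ (fun γ => if ρ ((γ : Γ) • x) < ρ x then some (c ((γ : Γ) • x)) else none)
      ⟨γ, Finset.mem_erase.2 ⟨h1, hγ⟩⟩
    rw [if_pos hlt, ← hcx x] at this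
    exact this (congrArg some heq)
  refine ⟨c, hc, fun x γ hγ h1 => ?_⟩
  rcases lt_or_gt_of_ne (hρR x γ hγ h1) with h | h
  · exact key x γ hγ h1 h
  · have := key (γ • x) γ⁻¹ (hR γ hγ) (by simpa using h1) (by simpa using h)
    simpa using this.symm

end LocallyConstant

/-! ### Counting bit vectors subject to constraints -/

section Counting

theorem card_le_two_pow_of_determined {n : ℕ} (s : Finset (Fin n → Bool)) (H : Finset (Fin n))
    (h : ∀ v ∈ s, ∀ v' ∈ s, (∀ i ∈ H, v i = v' i) → v = v') : s.card ≤ 2 ^ H.card := by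
  classical
  have : s.card ≤ (Finset.univ : Finset (H → Bool)).card := by
    refine Finset.card_le_card_of_injOn (fun v i => v i) (fun _ _ => Finset.mem_univ _) ?_
    intro v hv v' hv' heq
    exact h v hv v' hv' fun i hi => congrFun heq ⟨i, hi⟩
  simpa using this

theorem card_le_four_of_fixed {n : ℕ} (s : Finset (Fin n → Bool)) (G : Finset (Fin n))
    (hG : Gᶜ.card ≤ 2) (b : Fin n → Bool) (h : ∀ i ∈ G, ∀ v ∈ s, v i = b i) : s.card ≤ 4 := by
  refine (card_le_two_pow_of_determined s Gᶜ ?_).trans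
    ((Nat.pow_le_pow_right (by norm_num) hG).trans (by norm_num))
  intro v hv v' hv' hvv
  funext i
  by_cases hi : i ∈ G
  · rw [h i hi v hv, h i hi v' hv']
  · exact hvv i (by simpa using hi)

/-- Orient each link to an earlier or a later coordinate. One of the two kinds (fixed ones counted
with the earlier) makes up at least half of `G`, and those coordinates are redundant by induction
upwards or downwards, leaving at most `l + 1` free ones. -/
theorem card_le_of_linked {l : ℕ} (s : Finset (Fin (2 * l) → Bool)) (G : Finset (Fin (2 * l)))
    (hG : Gᶜ.card ≤ 2)
    (h : ∀ i ∈ G, (∃ b, ∀ v ∈ s, v i = b) ∨ ∃ j, j ≠ i ∧ ∀ v ∈ s, v i = v j) :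
    s.card ≤ 2 ^ (l + 1) := by
  classical
  let p : Fin (2 * l) → Prop := fun i =>
    (∃ b, ∀ v ∈ s, v i = b) ∨ ∃ j, j < i ∧ ∀ v ∈ s, v i = v j
  have h1 : s.card ≤ 2 ^ ((G.filter p)ᶜ).card := by
    refine card_le_two_pow_of_determined s _ fun v hv v' hv' hvv => ?_
    have : ∀ m, ∀ i : Fin (2 * l), (i : ℕ) = m → v i = v' i := by
      intro m
      induction m using Nat.strong_induction_on with
      | _ m ih =>
        intro i hi
        by_cases hp : i ∈ G.filter p
        · rcases (Finset.mem_filter.1 hp).2 with ⟨b, hb⟩ | ⟨j, hj, hb⟩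
          · rw [hb v hv, hb v' hv']
          · rw [hb v hv, hb v' hv']
            exact ih j (hi ▸ hj) j rfl
        · exact hvv i (Finset.mem_compl.2 hp)
    exact funext fun i => this _ i rfl
  have h2 : s.card ≤ 2 ^ ((G.filter fun i => ¬ p i)ᶜ).card := by
    refine card_le_two_pow_of_determined s _ fun v hv v' hv' hvv => ?_
    have : ∀ m, ∀ i : Fin (2 * l), 2 * l - (i : ℕ) = m → v i = v' i := by
      intro m
      induction m using Nat.strong_induction_on with
      | _ m ih =>
        intro i hi
        by_cases hp : i ∈ G.filter fun i => ¬ p i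
        · obtain ⟨hiG, hpi⟩ := Finset.mem_filter.1 hp
          rcases h i hiG with hb | ⟨j, hj, hb⟩
          · exact absurd (Or.inl hb) hpi
          · rcases lt_or_gt_of_ne hj with hlt | hlt
            · exact absurd (Or.inr ⟨j, hlt, hb⟩) hpi
            · rw [hb v hv, hb v' hv']
              have : (i : ℕ) < j := hlt
              exact ih (2 * l - j) (by omega) j rfl
        · exact hvv i (Finset.mem_compl.2 hp)
    exact funext fun i => this _ i rfl
  have h3 := Finset.card_filter_add_card_filter_not (s := G) p
  have c1 := Finset.card_compl_add_card (G.filter p)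
  have c2 := Finset.card_compl_add_card (G.filter fun i => ¬ p i)
  have c3 := Finset.card_compl_add_card G
  simp only [Fintype.card_fin] at c1 c2 c3
  by_cases hc : ((G.filter p)ᶜ).card ≤ l + 1
  · exact h1.trans (Nat.pow_le_pow_right (by norm_num) hc)
  · exact h2.trans (Nat.pow_le_pow_right (by norm_num) (by omega))

open Classical in
-- Double counting: there are at most `4 * 4 ^ l` related pairs, and each `v` counted here lies in
-- more than `2 ^ l` of them.
theorem card_filter_many_le {V : Type*} [Fintype V] {l : ℕ} (hV : Fintype.card V = 4 ^ l)
    (r : V → V → Prop) (h : ∀ w, (Finset.univ.filter fun v => r v w).card ≤ 4) :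
    (Finset.univ.filter fun v => ¬ (Finset.univ.filter fun w => r v w).card ≤ 2 ^ l).card
      ≤ 4 * 2 ^ l := by
  have e := Finset.sum_card_bipartiteAbove_eq_sum_card_bipartiteBelow
    (s := (Finset.univ : Finset V)) (t := (Finset.univ : Finset V)) r
  have h1 : ∑ w : V, (Finset.univ.filter fun v => r v w).card ≤ 4 ^ l * 4 := by
    have := Finset.sum_le_card_nsmul (Finset.univ : Finset V) _ 4 fun w _ => h w
    simpa [hV] using this
  have h2 : (Finset.univ.filter fun v => ¬ (Finset.univ.filter fun w => r v w).card ≤ 2 ^ l).card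
      * 2 ^ l ≤ ∑ v : V, (Finset.univ.filter fun w => r v w).card := by
    refine le_trans ?_ (Finset.sum_le_sum_of_subset
      (Finset.subset_univ (Finset.univ.filter fun v =>
        ¬ (Finset.univ.filter fun w => r v w).card ≤ 2 ^ l)))
    rw [← smul_eq_mul]
    refine Finset.card_nsmul_le_sum _ _ _ fun v hv => ?_
    have := (Finset.mem_filter.1 hv).2
    omega
  have h3 : (4 : ℕ) ^ l * 4 = (4 * 2 ^ l) * 2 ^ l := by
    rw [show (4 : ℕ) = 2 * 2 by norm_num, mul_pow]; ring
  refine Nat.le_of_mul_le_mul_right ?_ (show 0 < 2 ^ l by positivity)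
  rw [← h3]
  refine h2.trans (le_trans (le_of_eq ?_) h1)
  simpa [Finset.bipartiteAbove, Finset.bipartiteBelow] using e

end Counting

/-! ### A greedy local lemma for binary constraints -/

section Assignment

variable {Γ : Type u} [Group Γ] {X : Type v} [TopologicalSpace X] [MulAction Γ X]
  [ContinuousConstSMul Γ X]

open Classical in
/-- A continuous local lemma for constraints on one or two variables: each point of a set `M` picks
a value so that none of the given failures, which involve the point alone or the point and one
nearby point of `M`, takes place. -/
theorem exists_assignment {V : Type} [Fintype V] {l : ℕ} (hV : Fintype.card V = 4 ^ l)
    (C N : Finset Γ) (hN : ∀ η ∈ N, η⁻¹ ∈ N) (hCN : 11 * (C.card * N.card) < 2 ^ l)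
    (hN1 : N.Nonempty) {ρ : X → ℕ} (hρ : IsLocallyConstant ρ)
    (hρN : ∀ x, ∀ η ∈ N, η ≠ 1 → ρ (η • x) ≠ ρ x) (M : X → Prop)
    (self : X → Γ → V → Prop) (hself : ∀ c v, IsLocallyConstant fun x => self x c v)
    (fail : X → Γ → Γ → V → V → Prop)
    (hfail : ∀ c η v w, IsLocallyConstant fun x => fail x c η v w)
    (hself_card : ∀ x, M x → ∀ c ∈ C, ∀ s : Finset V, (∀ v ∈ s, self x c v) →
      s.card ≤ 2 ^ (l + 1))
    (hfail_card : ∀ x, M x → ∀ c ∈ C, ∀ η w, ∀ s : Finset V, (∀ v ∈ s, fail x c η v w) →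
      s.card ≤ 4) :
    ∃ φ : X → V, IsLocallyConstant φ ∧ ∀ x, M x → ∀ c ∈ C, ¬ self x c (φ x) ∧
      ∀ η ∈ N, η ≠ 1 → M (η • x) → ¬ fail x c η (φ x) (φ (η • x)) := by
  replace hself_card : ∀ x, M x → ∀ c ∈ C,
      (Finset.univ.filter fun v => self x c v).card ≤ 2 ^ (l + 1) := fun x hx c hc =>
    hself_card x hx c hc _ fun v hv => (Finset.mem_filter.1 hv).2
  replace hfail_card : ∀ x, M x → ∀ c ∈ C, ∀ η w,
      (Finset.univ.filter fun v => fail x c η v w).card ≤ 4 := fun x hx c hc η w =>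
    hfail_card x hx c hc η w _ fun v hv => (Finset.mem_filter.1 hv).2
  have hVne : Nonempty V := by
    rw [← Fintype.card_pos_iff, hV]; positivity
  let few : (V → Prop) → Prop := fun q => (Finset.univ.filter q).card ≤ 2 ^ l
  -- A constraint is controlled directly if `x` chooses after its partner. If `x` chooses first, it
  -- must leave `few` bad values to the partner, so that the partner can avoid them in its turn. The
  -- condition `few` on `f'` keeps the count valid for neighbors outside `M` too.
  let Good : (C → V → Prop) → (C → N → V → V → Prop) → (C → N → V → V → Prop) →
      (N → Option V) → V → Prop := fun s f f' o v => ∀ c, ¬ s c v ∧ ∀ η, few (f c η v) ∧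
        ∀ w, o η = some w → ¬ f c η v w ∧ (few (f' c η w) → ¬ f' c η w v)
  let pick : ((N → Option V) → V → Prop) → (N → Option V) → V := fun G o =>
    if h : ∃ v, G o v then h.choose else Classical.arbitrary V
  let s : X → C → V → Prop := fun x c => self x c
  let f : X → C → N → V → V → Prop := fun x c η => fail x c η
  let f' : X → C → N → V → V → Prop := fun x c η => fail ((η : Γ) • x) c (η : Γ)⁻¹
  have hs : IsLocallyConstant s :=
    isLocallyConstant_pi fun c => isLocallyConstant_pi fun v => hself c v
  have hf : IsLocallyConstant f := isLocallyConstant_pi fun c => isLocallyConstant_pi fun η =>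
    isLocallyConstant_pi fun v => isLocallyConstant_pi fun w => hfail c η v w
  have hf' : IsLocallyConstant f' := isLocallyConstant_pi fun c => isLocallyConstant_pi fun η =>
    isLocallyConstant_pi fun v => isLocallyConstant_pi fun w =>
      isLocallyConstant_const_smul (hfail c (η : Γ)⁻¹ v w) (η : Γ)
  have hΦ : IsLocallyConstant fun x => pick (Good (s x) (f x) (f' x)) :=
    (hs.prodMk (hf.prodMk hf')).comp fun t => pick (Good t.1 t.2.1 t.2.2)
  obtain ⟨φ, hφ, hφx⟩ := exists_greedy N hρ hΦ
  have hex : ∀ x, M x → ∀ o, ∃ v, Good (s x) (f x) (f' x) o v := by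
    intro x hx o
    let bad : C × N → Finset V := fun p =>
      ((Finset.univ.filter fun v => s x p.1 v) ∪
        (Finset.univ.filter fun v => ¬ few (f x p.1 p.2 v))) ∪
      ((Finset.univ.filter fun v => ∃ w, o p.2 = some w ∧ f x p.1 p.2 v w) ∪
        (Finset.univ.filter fun v => ∃ w, o p.2 = some w ∧ few (f' x p.1 p.2 w) ∧
          f' x p.1 p.2 w v))
    -- The constant is `11 = 2 + 4 + 4 + 1`: self-constraints, values leaving too many bad choices,
    -- failures against an earlier partner (`4 ≤ 4 * 2 ^ l`), and failures seen from that partner.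
    have hbad : ∀ p, (bad p).card ≤ 11 * 2 ^ l := by
      intro p
      have h1 := hself_card x hx p.1 p.1.2
      have h2 := card_filter_many_le hV (f x p.1 p.2) fun w => hfail_card x hx p.1 p.1.2 p.2 w
      have h3 : (Finset.univ.filter fun v => ∃ w, o p.2 = some w ∧ f x p.1 p.2 v w).card ≤ 4 := by
        cases ho : o p.2 with
        | none => simp
        | some w => simpa [ho] using hfail_card x hx p.1 p.1.2 p.2 w
      have h4 : (Finset.univ.filter fun v => ∃ w, o p.2 = some w ∧ few (f' x p.1 p.2 w) ∧
          f' x p.1 p.2 w v).card ≤ 2 ^ l := by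
        cases ho : o p.2 with
        | none => simp
        | some w =>
          by_cases hw : few (f' x p.1 p.2 w)
          · refine le_trans (Finset.card_le_card fun v hv => ?_) hw
            obtain ⟨w', hw', -, hv'⟩ := (Finset.mem_filter.1 hv).2
            cases hw'
            exact Finset.mem_filter.2 ⟨Finset.mem_univ _, hv'⟩
          · simp [hw]
      have u1 := Finset.card_union_le (Finset.univ.filter fun v => s x p.1 v)
        (Finset.univ.filter fun v => ¬ few (f x p.1 p.2 v))
      have u2 := Finset.card_union_le
        (Finset.univ.filter fun v => ∃ w, o p.2 = some w ∧ f x p.1 p.2 v w)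
        (Finset.univ.filter fun v => ∃ w, o p.2 = some w ∧ few (f' x p.1 p.2 w) ∧
          f' x p.1 p.2 w v)
      have u3 := Finset.card_union_le ((Finset.univ.filter fun v => s x p.1 v) ∪
        (Finset.univ.filter fun v => ¬ few (f x p.1 p.2 v)))
        ((Finset.univ.filter fun v => ∃ w, o p.2 = some w ∧ f x p.1 p.2 v w) ∪
        (Finset.univ.filter fun v => ∃ w, o p.2 = some w ∧ few (f' x p.1 p.2 w) ∧
          f' x p.1 p.2 w v))
      have hpos : 1 ≤ 2 ^ l := Nat.one_le_two_pow
      have hsucc : 2 ^ (l + 1) = 2 * 2 ^ l := by ring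
      change (Finset.univ.filter fun v => s x p.1 v).card ≤ _ at h1
      change (Finset.univ.filter fun v => ¬ few (f x p.1 p.2 v)).card ≤ _ at h2
      change Finset.card (_ ∪ _) ≤ _
      omega
    have hunion : ((Finset.univ : Finset (C × N)).biUnion bad).card < Fintype.card V := by
      have := Finset.card_biUnion_le_card_mul (Finset.univ : Finset (C × N)) bad _ fun p _ => hbad p
      refine this.trans_lt ?_
      rw [hV, Finset.card_univ, Fintype.card_prod, Fintype.card_coe, Fintype.card_coe,
        show (4 : ℕ) = 2 * 2 by norm_num, mul_pow]
      have hpos : 0 < 2 ^ l := by positivity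
      calc C.card * N.card * (11 * 2 ^ l) = (11 * (C.card * N.card)) * 2 ^ l := by ring
        _ < 2 ^ l * 2 ^ l := Nat.mul_lt_mul_of_pos_right hCN hpos
    obtain ⟨v, hv⟩ : ∃ v, v ∉ (Finset.univ : Finset (C × N)).biUnion bad := by
      by_contra! h
      rw [Finset.eq_univ_iff_forall.2 h, Finset.card_univ] at hunion
      exact lt_irrefl _ hunion
    have hv' : ∀ c η, v ∉ bad (c, η) := fun c η h =>
      hv (Finset.mem_biUnion.2 ⟨_, Finset.mem_univ _, h⟩)
    simp only [bad, Finset.mem_union, Finset.mem_filter, Finset.mem_univ, true_and, not_or,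
      not_exists, not_and, not_not] at hv'
    obtain ⟨η₀, hη₀⟩ := hN1
    exact ⟨v, fun c => ⟨(hv' c ⟨η₀, hη₀⟩).1.1, fun η => ⟨(hv' c η).1.2, fun w hw =>
      ⟨(hv' c η).2.1 w hw, (hv' c η).2.2 w hw⟩⟩⟩⟩
  have hgood : ∀ x, M x → Good (s x) (f x) (f' x) (fun γ =>
      if ρ ((γ : Γ) • x) < ρ x then some (φ ((γ : Γ) • x)) else none) (φ x) := by
    intro x hx
    have h := hex x hx fun γ => if ρ ((γ : Γ) • x) < ρ x then some (φ ((γ : Γ) • x)) else none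
    have hx' := hφx x
    simp only [pick] at hx'
    rw [dif_pos h] at hx'
    rw [hx']
    exact h.choose_spec
  refine ⟨φ, hφ, fun x hx c hc => ⟨(hgood x hx ⟨c, hc⟩).1, fun η hη h1 hM hbad => ?_⟩⟩
  rcases lt_or_gt_of_ne (hρN x η hη h1) with h | h
  · exact (((hgood x hx ⟨c, hc⟩).2 ⟨η, hη⟩).2 (φ (η • x)) (if_pos h)).1 hbad
  · have h2 := (((hgood (η • x) hM ⟨c, hc⟩).2 ⟨η⁻¹, hN η hη⟩).2 (φ x)
      (by simp [h])).2
    have h3 := ((hgood x hx ⟨c, hc⟩).2 ⟨η, hη⟩).1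
    simp only [f', f, inv_smul_smul, inv_inv] at h2 h3
    exact h2 h3 hbad

end Assignment

/-! ### Breaking one period -/

section Breaking

open Classical in
/-- The truth value of a proposition. -/
noncomputable def boolOf (p : Prop) : Bool := decide p

theorem boolOf_eq_true {p : Prop} : boolOf p = true ↔ p := by simp [boolOf]

theorem boolOf_eq_false {p : Prop} : boolOf p = false ↔ ¬ p := by simp [boolOf]

open Filter

variable {Γ : Type u} [Group Γ]

theorem inv_union_finset [DecidableEq Γ] (s t : Finset Γ) : (s ∪ t)⁻¹ = s⁻¹ ∪ t⁻¹ := by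
  ext x
  simp only [Finset.mem_inv', Finset.mem_union]

theorem exists_disjoint_translates [Infinite Γ] [DecidableEq Γ] (E : Finset Γ) :
    ∃ g : ℕ → Γ, ∀ i j, ∀ e ∈ E, ∀ e' ∈ E, e * g i = e' * g j → i = j := by
  let r : Γ → Γ → Prop := fun x y => ∀ e ∈ E, ∀ e' ∈ E, e * x ≠ e' * y
  have : Std.Symm r := ⟨fun x y h e he e' he' heq => h e' he' e he heq.symm⟩
  obtain ⟨g, -, hg⟩ := exists_seq_of_forall_finset_exists' (fun _ : Γ => True) r fun s _ => by
    obtain ⟨y, hy⟩ := Infinite.exists_notMem_finset (E⁻¹ * E * s)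
    refine ⟨y, trivial, fun x hx e he e' he' heq => hy ?_⟩
    have : y = e'⁻¹ * e * x := by rw [mul_assoc, heq, inv_mul_cancel_left]
    rw [this]
    exact Finset.mul_mem_mul (Finset.mul_mem_mul (Finset.inv_mem_inv he') he) hx
  refine ⟨g, fun i j e he e' he' heq => ?_⟩
  by_contra hij
  exact hg hij e he e' he' heq

theorem exists_mul_pow_lt_two_pow (K : ℕ) : ∃ l : ℕ, 1 ≤ l ∧ K * l ^ 10 < 2 ^ l := by
  have h := tendsto_pow_const_div_const_pow_of_one_lt 10 (r := (2 : ℝ)) (by norm_num)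
  have h2 := h.eventually (gt_mem_nhds (show (0 : ℝ) < 1 / (K + 1) by positivity))
  obtain ⟨l, hl, hl1⟩ := (h2.and (eventually_ge_atTop 1)).exists
  refine ⟨l, hl1, ?_⟩
  rw [div_lt_div_iff₀ (by positivity) (by positivity)] at hl
  have h3 : (K : ℝ) * l ^ 10 < 2 ^ l := by
    have : (0 : ℝ) ≤ (l : ℝ) ^ 10 := by positivity
    nlinarith
  exact_mod_cast h3

/-- The finite sets that govern one step of the construction of aperiodic points. -/
theorem exists_scale [Infinite Γ] [DecidableEq Γ] (E : Finset Γ) (hE : E.Nonempty) (γ : Γ) :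
    ∃ (l : ℕ) (g : Fin (2 * l) → Γ) (Q A C N : Finset Γ), Q.Nonempty ∧
      (∀ i, ∀ e ∈ E, e * g i ∈ Q) ∧
      (∀ i j, ∀ e ∈ E, ∀ e' ∈ E, e * g i = e' * g j → i = j) ∧
      A = Q⁻¹ * Q * (Q⁻¹ * Q) ∪ Q * Q⁻¹ ∧
      C = (A * E).image (fun t => t * γ * t⁻¹) ∧
      N = Q⁻¹ * Q * C ∪ (Q⁻¹ * Q * C)⁻¹ ∧
      11 * (C.card * N.card) < 2 ^ l := by
  obtain ⟨g, hg⟩ := exists_disjoint_translates E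
  -- With `Q.card ≤ E.card * (2 * l)`, the product `C.card * N.card` is polynomial of degree `10` in
  -- `l`; the constant is the one produced by the final estimate.
  obtain ⟨l, hl, hlK⟩ := exists_mul_pow_lt_two_pow (88 * (2 * E.card) ^ 10 * E.card ^ 2)
  let Q : Finset Γ := E * Finset.univ.image fun i : Fin (2 * l) => g i
  let A : Finset Γ := Q⁻¹ * Q * (Q⁻¹ * Q) ∪ Q * Q⁻¹
  let C : Finset Γ := (A * E).image (fun t => t * γ * t⁻¹)
  let N : Finset Γ := Q⁻¹ * Q * C ∪ (Q⁻¹ * Q * C)⁻¹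
  have hQne : Q.Nonempty := hE.mul ⟨g 0, Finset.mem_image.2 ⟨⟨0, by omega⟩, by simp, rfl⟩⟩
  refine ⟨l, fun i => g i, Q, A, C, N, hQne,
    fun i e he => Finset.mul_mem_mul he (Finset.mem_image_of_mem _ (Finset.mem_univ i)),
    fun i j e he e' he' h => Fin.ext (hg i j e he e' he' h), rfl, rfl, rfl, lt_of_le_of_lt ?_ hlK⟩
  have hq1 : 1 ≤ Q.card := Finset.card_pos.2 hQne
  have hq : Q.card ≤ E.card * (2 * l) := by
    refine Finset.card_mul_le.trans (Nat.mul_le_mul_left _ ?_)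
    exact Finset.card_image_le.trans (by simp)
  have hqq : (Q⁻¹ * Q).card ≤ Q.card ^ 2 := by
    refine Finset.card_mul_le.trans ?_
    rw [Finset.card_inv, sq]
  have hA : A.card ≤ 2 * Q.card ^ 4 := by
    have h1 : (Q⁻¹ * Q * (Q⁻¹ * Q)).card ≤ Q.card ^ 4 := by
      refine Finset.card_mul_le.trans ((Nat.mul_le_mul hqq hqq).trans (le_of_eq (by ring)))
    have h2 : (Q * Q⁻¹).card ≤ Q.card ^ 4 := by
      refine Finset.card_mul_le.trans ?_
      rw [Finset.card_inv, ← sq]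
      exact Nat.pow_le_pow_right hq1 (by norm_num)
    have := Finset.card_union_le (Q⁻¹ * Q * (Q⁻¹ * Q)) (Q * Q⁻¹)
    change Finset.card (_ ∪ _) ≤ _
    omega
  have hC : C.card ≤ 2 * Q.card ^ 4 * E.card :=
    Finset.card_image_le.trans (Finset.card_mul_le.trans (Nat.mul_le_mul_right _ hA))
  have hN : N.card ≤ 2 * (Q.card ^ 2 * C.card) := by
    have h1 : (Q⁻¹ * Q * C).card ≤ Q.card ^ 2 * C.card :=
      Finset.card_mul_le.trans (Nat.mul_le_mul_right _ hqq)
    have := Finset.card_union_le (Q⁻¹ * Q * C) (Q⁻¹ * Q * C)⁻¹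
    rw [Finset.card_inv] at this
    change Finset.card (_ ∪ _) ≤ _
    omega
  calc 11 * (C.card * N.card) ≤ 11 * (C.card * (2 * (Q.card ^ 2 * C.card))) := by gcongr
    _ = 22 * Q.card ^ 2 * C.card ^ 2 := by ring
    _ ≤ 22 * Q.card ^ 2 * (2 * Q.card ^ 4 * E.card) ^ 2 := by gcongr
    _ = 88 * Q.card ^ 10 * E.card ^ 2 := by ring
    _ ≤ 88 * (E.card * (2 * l)) ^ 10 * E.card ^ 2 := by gcongr
    _ = 88 * (2 * E.card) ^ 10 * E.card ^ 2 * l ^ 10 := by ring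

variable {X : Type v} [TopologicalSpace X] [MulAction Γ X] [ContinuousConstSMul Γ X]

/-- The choice is a function of the finitely many truth values `B (e • x)`, hence locally constant.
-/
theorem exists_locallyConstant_choice (E : Finset Γ) (hE : E.Nonempty) {B : X → Prop}
    (hB : IsLocallyConstant B) (hBE : ∀ x, ∃ t ∈ E, B (t • x)) :
    ∃ t : X → Γ, IsLocallyConstant t ∧ ∀ x, t x ∈ E ∧ B (t x • x) := by
  classical
  let pick : (E → Prop) → Γ := fun p => if h : ∃ e, p e then (h.choose : Γ) else hE.choose
  refine ⟨fun x => pick fun e => B ((e : Γ) • x),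
    (isLocallyConstant_pi fun e : E => isLocallyConstant_const_smul hB (e : Γ)).comp pick,
    fun x => ?_⟩
  have h : ∃ e : E, B ((e : Γ) • x) := by
    obtain ⟨t, ht, h⟩ := hBE x
    exact ⟨⟨t, ht⟩, h⟩
  simp only [pick, dif_pos h]
  exact ⟨h.choose.2, h.choose_spec⟩

/-- A clopen set has a clopen maximal `A`-separated subset. -/
theorem exists_separated_subset [DecidableEq Γ] (A : Finset Γ) (hA : ∀ α ∈ A, α⁻¹ ∈ A)
    (hA1 : 1 ∈ A) {ρ : X → ℕ} (hρ : IsLocallyConstant ρ)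
    (hρA : ∀ x, ∀ α ∈ A, α ≠ 1 → ρ (α • x) ≠ ρ x) {B : X → Prop} (hB : IsLocallyConstant B) :
    ∃ B' : X → Prop, IsLocallyConstant B' ∧ (∀ x, B' x → B x) ∧
      (∀ x, ∀ α ∈ A, B' x → B' (α • x) → α = 1) ∧ ∀ x, B x → ∃ α ∈ A, B' (α • x) := by
  classical
  -- A point of `B` joins `B'` unless an `A`-neighbor of smaller rank has already joined.
  let Φ : Prop → (A → Option Prop) → Prop := fun q o => q ∧ ∀ α : A, (α : Γ) ≠ 1 → o α ≠ some True
  obtain ⟨B', hB', h⟩ := exists_greedy A hρ (hB.comp Φ)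
  have h' : ∀ x, B' x ↔ B x ∧ ∀ α ∈ A, α ≠ 1 → ρ (α • x) < ρ x → ¬ B' (α • x) := by
    intro x
    rw [h x]
    simp only [Φ, Function.comp, ne_eq, Subtype.forall]
    refine and_congr_right fun _ => forall₃_congr fun α hα h1 => ?_
    split_ifs with hlt
    · simp [hlt]
    · simp [hlt]
  have key : ∀ x, ∀ α ∈ A, B' x → B' (α • x) → ρ (α • x) < ρ x → α = 1 := by
    intro x α hα hx hαx hlt
    by_contra h1
    exact ((h' x).1 hx).2 α hα h1 hlt hαx
  refine ⟨B', hB', fun x hx => ((h' x).1 hx).1, fun x α hα hx hαx => ?_, fun x hx => ?_⟩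
  · by_contra h1
    rcases lt_or_gt_of_ne (hρA x α hα h1) with hlt | hlt
    · exact h1 (key x α hα hx hαx hlt)
    · have := key (α • x) α⁻¹ (hA α hα) hαx (by simpa using hx) (by simpa using hlt)
      exact h1 (inv_eq_one.1 this)
  · by_cases hx' : B' x
    · exact ⟨1, hA1, by simpa using hx'⟩
    · have := mt (h' x).2 hx'
      push Not at this
      obtain ⟨α, hα, -, -, hb⟩ := this hx
      exact ⟨α, hα, hb⟩

open Classical in
/-- One step of the construction of aperiodic points: the values of `b` on a syndetic clopen set `B`
can be redefined so that the period `γ` is excluded everywhere, whatever happens later on a smaller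
syndetic clopen set `B'`. -/
theorem exists_breaking_step [Infinite Γ] [DecidableEq Γ] (E : Finset Γ) (hE : E.Nonempty) (γ : Γ)
    (hγ : γ ≠ 1) :
    ∃ E' T : Finset Γ, E'.Nonempty ∧ ∀ (X : Type v) [TopologicalSpace X]
      [SecondCountableTopology X] [T2Space X] [MulAction Γ X] [ContinuousConstSMul Γ X],
      ZeroDimensional X → FreeAction Γ X →
      ∀ B : X → Prop, IsLocallyConstant B → (∀ x, ∃ t ∈ E, B (t • x)) →
      ∀ b : X → Bool, IsLocallyConstant b →
      ∃ B' : X → Prop, IsLocallyConstant B' ∧ (∀ x, B' x → B x) ∧ (∀ x, ∃ t ∈ E', B' (t • x)) ∧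
      ∃ b₁ : X → Bool, IsLocallyConstant b₁ ∧ (∀ x, ¬ B x → b₁ x = b x) ∧
        ∀ b₂ : X → Bool, (∀ x, ¬ B' x → b₂ x = b₁ x) →
          ∀ x, ∃ t ∈ T, b₂ (t • x) ≠ b₂ ((t * γ) • x) := by
  obtain ⟨l, g, Q, A, C, N, hQne, hgQ, hg, hA, hC, hN, hcard⟩ := exists_scale E hE γ
  have hAsymm : ∀ α ∈ A, α⁻¹ ∈ A := by
    have : A⁻¹ = A := by rw [hA, inv_union_finset]; simp [mul_inv_rev]
    intro α hα
    rw [← this]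
    exact Finset.inv_mem_inv hα
  have hNsymm : ∀ α ∈ N, α⁻¹ ∈ N := by
    have : N⁻¹ = N := by rw [hN, inv_union_finset, inv_inv, Finset.union_comm]
    intro α hα
    rw [← this]
    exact Finset.inv_mem_inv hα
  -- Separation by `Q⁻¹ * Q` makes the cells of distinct points of `B'` disjoint, the fourfold
  -- products make the partner of a translated block of cells unique, and `Q * Q⁻¹` lets at most one
  -- cell of a point meet `B'`.
  have hA4 : ∀ q₁ ∈ Q, ∀ q₂ ∈ Q, ∀ q₃ ∈ Q, ∀ q₄ ∈ Q, q₁⁻¹ * q₂ * (q₃⁻¹ * q₄) ∈ A := by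
    intro q₁ h₁ q₂ h₂ q₃ h₃ q₄ h₄
    rw [hA]
    exact Finset.mem_union_left _ (Finset.mul_mem_mul
      (Finset.mul_mem_mul (Finset.inv_mem_inv h₁) h₂)
      (Finset.mul_mem_mul (Finset.inv_mem_inv h₃) h₄))
  have hA2 : ∀ q₁ ∈ Q, ∀ q₂ ∈ Q, q₁⁻¹ * q₂ ∈ A := by
    intro q₁ h₁ q₂ h₂
    simpa using hA4 q₁ h₁ q₂ h₂ q₁ h₁ q₁ h₁
  have hA2' : ∀ q₁ ∈ Q, ∀ q₂ ∈ Q, q₁ * q₂⁻¹ ∈ A := by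
    intro q₁ h₁ q₂ h₂
    rw [hA]
    exact Finset.mem_union_right _ (Finset.mul_mem_mul h₁ (Finset.inv_mem_inv h₂))
  have hA1 : (1 : Γ) ∈ A := by
    obtain ⟨q, hq⟩ := hQne
    simpa using hA2 q hq q hq
  have hNmem : ∀ q₁ ∈ Q, ∀ q₂ ∈ Q, ∀ c ∈ C, q₁⁻¹ * q₂ * c ∈ N := by
    intro q₁ h₁ q₂ h₂ c hc
    rw [hN]
    exact Finset.mem_union_left _ (Finset.mul_mem_mul
      (Finset.mul_mem_mul (Finset.inv_mem_inv h₁) h₂) hc)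
  have hAE : (A * E).Nonempty := Finset.Nonempty.mul ⟨1, hA1⟩ hE
  have hC1 : ∀ c ∈ C, c ≠ 1 := by
    intro c hc h1
    rw [hC] at hc
    obtain ⟨t, -, rfl⟩ := Finset.mem_image.1 hc
    exact hγ (by simpa using h1)
  have hCne : C.Nonempty := by rw [hC]; exact hAE.image _
  have hNne : N.Nonempty := by
    obtain ⟨c, hc⟩ := hCne
    obtain ⟨q, hq⟩ := hQne
    exact ⟨_, hNmem q hq q hq c hc⟩
  refine ⟨A * E, Q * (A * E), hAE, ?_⟩
  intro X _ _ _ _ _ hX hfree B hB hBE b hb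
  obtain ⟨ρ, hρ, hρR⟩ := exists_rank hX hfree (A ∪ N)
  obtain ⟨B', hB', hB'B, hsep, hmax⟩ := exists_separated_subset A hAsymm hA1 hρ
    (fun x α hα h1 => hρR x α (Finset.mem_union_left _ hα) h1) hB
  have hsyn : ∀ x, ∃ t ∈ A * E, B' (t • x) := by
    intro x
    obtain ⟨e, he, hex⟩ := hBE x
    obtain ⟨α, hα, h⟩ := hmax _ hex
    exact ⟨α * e, Finset.mul_mem_mul hα he, by rwa [mul_smul]⟩
  obtain ⟨t, ht, htx⟩ := exists_locallyConstant_choice E hE hB hBE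
  let a : Fin (2 * l) → X → Γ := fun i x => t (g i • x) * g i
  have ha : ∀ i, IsLocallyConstant (a i) := fun i =>
    (isLocallyConstant_const_smul ht (g i)).comp fun s => s * g i
  have haQ : ∀ i x, a i x ∈ Q := fun i x => hgQ i _ (htx _).1
  have haB : ∀ i x, B (a i x • x) := fun i x => by
    simp only [a, mul_smul]
    exact (htx (g i • x)).2
  have hainj : ∀ i j x y, a i x = a j y → i = j := fun i j x y h =>
    hg i j _ (htx _).1 _ (htx _).1 h
  -- the bit at `δ • x` if the cells of `η • x` carry the bits `w`
  let cell : X → Γ → (Fin (2 * l) → Bool) → Γ → Bool := fun x η w δ =>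
    if B (δ • x) then boolOf (∃ j, a j (η • x) * η = δ ∧ w j = true) else b (δ • x)
  let fail : X → Γ → Γ → (Fin (2 * l) → Bool) → (Fin (2 * l) → Bool) → Prop :=
    fun x c η v w => ∀ i, ¬ B' (a i x • x) → ¬ B' ((a i x * c) • x) →
      v i = cell x η w (a i x * c)
  have hfail : ∀ c η v w, IsLocallyConstant fun x => fail x c η v w := by
    intro c η v w
    refine isLocallyConstant_forall fun i => ?_
    have hδ : IsLocallyConstant fun x => a i x * c := (ha i).comp fun s => s * c
    have h1 := isLocallyConstant_smul (ha i) hB'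
    have h2 := isLocallyConstant_smul hδ hB'
    have h3 := isLocallyConstant_smul hδ hB
    have h4 := isLocallyConstant_smul hδ hb
    have h5 : IsLocallyConstant fun x => ∃ j, a j (η • x) * η = a i x * c ∧ w j = true := by
      refine isLocallyConstant_exists fun j => ?_
      exact ((isLocallyConstant_const_smul (ha j) η).prodMk hδ).comp fun s =>
        s.1 * η = s.2 ∧ w j = true
    exact (h1.prodMk (h2.prodMk (h3.prodMk (h4.prodMk h5)))).comp fun s =>
      ¬ s.1 → ¬ s.2.1 → v i = if s.2.2.1 then boolOf s.2.2.2.2 else s.2.2.2.1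
  -- The comparisons that survive arbitrary later changes on `B'`. By separation at most one index
  -- is lost at each end.
  let G : X → Γ → Finset (Fin (2 * l)) := fun x c =>
    Finset.univ.filter fun i => ¬ B' (a i x • x) ∧ ¬ B' ((a i x * c) • x)
  have hG : ∀ x c, (G x c)ᶜ.card ≤ 2 := by
    intro x c
    have hone : ∀ c, (Finset.univ.filter fun i => B' ((a i x * c) • x)).card ≤ 1 := by
      intro c
      refine Finset.card_le_one.2 fun i hi j hj => ?_
      have hi' := (Finset.mem_filter.1 hi).2
      have hj' := (Finset.mem_filter.1 hj).2
      have := hsep _ (a j x * (a i x)⁻¹) (hA2' _ (haQ j x) _ (haQ i x)) hi'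
        (by rw [← mul_smul]; simpa [mul_assoc] using hj')
      exact (hainj j i x x (mul_inv_eq_one.1 this)).symm
    have h1 := hone 1
    have h2 := hone c
    simp only [mul_one] at h1
    refine le_trans (Finset.card_le_card (t := (Finset.univ.filter fun i => B' (a i x • x)) ∪
      (Finset.univ.filter fun i => B' ((a i x * c) • x))) fun i hi => ?_)
      ((Finset.card_union_le _ _).trans (Nat.add_le_add h1 h2))
    simp only [G, Finset.mem_compl, Finset.mem_filter, Finset.mem_univ, true_and, not_and_or,
      not_not] at hi
    simpa using hi
  obtain ⟨φ, hφ, hφx⟩ := exists_assignment (V := Fin (2 * l) → Bool) (l := l)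
    (by simp [pow_mul]) C N hNsymm hcard hNne hρ
    (fun x η hη h1 => hρR x η (Finset.mem_union_right _ hη) h1) B'
    (fun x c v => fail x c 1 v v) (fun c v => hfail c 1 v v) fail hfail
    (by
      intro x _ c hc s hs
      refine card_le_of_linked _ (G x c) (hG x c) fun i hi => ?_
      have hi' := (Finset.mem_filter.1 hi).2
      by_cases hBi : B ((a i x * c) • x)
      -- When `x` is its own partner, a translated cell is another cell of `x` (another one since `c
      -- ≠ 1`), or an unowned point of `B`, whose bit is `false` by default.
      · by_cases hj : ∃ j, a j x = a i x * c
        · obtain ⟨j, hj⟩ := hj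
          refine Or.inr ⟨j, ?_, fun v hv => ?_⟩
          · rintro rfl
            exact hC1 c hc (by simpa using hj)
          · have := hs v hv i hi'.1 hi'.2
            rw [this]
            simp only [cell, if_pos hBi, one_smul, mul_one]
            by_cases hvj : v j = true
            · rw [hvj, boolOf_eq_true]
              exact ⟨j, hj, hvj⟩
            · rw [Bool.eq_false_of_not_eq_true hvj, boolOf_eq_false]
              rintro ⟨j', hj', hv'⟩
              rw [hainj j' j x x (hj'.trans hj.symm)] at hv'
              exact hvj hv'
        · refine Or.inl ⟨false, fun v hv => ?_⟩
          have := hs v hv i hi'.1 hi'.2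
          rw [this]
          simp only [cell, if_pos hBi, one_smul, mul_one, boolOf_eq_false]
          rintro ⟨j, hj', -⟩
          exact hj ⟨j, hj'⟩
      · refine Or.inl ⟨b ((a i x * c) • x), fun v hv => ?_⟩
        have := hs v hv i hi'.1 hi'.2
        rw [this]
        simp only [cell, if_neg hBi])
    (by
      intro x _ c _ η w s hs
      refine card_le_four_of_fixed _ (G x c) (hG x c) (fun i => cell x η w (a i x * c))
        fun i hi v hv => ?_
      have hi' := (Finset.mem_filter.1 hi).2
      exact hs v hv i hi'.1 hi'.2)
  -- The possible owners `q⁻¹ • u` of `u` form a finite family, so this is locally constant.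
  let owned : X → Prop := fun u => ∃ q ∈ Q, ∃ i, B' (q⁻¹ • u) ∧ a i (q⁻¹ • u) = q ∧
    φ (q⁻¹ • u) i = true
  have howned : IsLocallyConstant owned := by
    refine isLocallyConstant_exists_mem Q fun q => isLocallyConstant_exists fun i => ?_
    exact isLocallyConstant_const_smul ((hB'.prodMk ((ha i).prodMk hφ)).comp fun s =>
      s.1 ∧ s.2.1 = q ∧ s.2.2 i = true) q⁻¹
  let b₁ : X → Bool := fun u => if B u then boolOf (owned u) else b u
  refine ⟨B', hB', hB'B, hsyn, b₁, (hB.prodMk (howned.prodMk hb)).comp fun s =>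
    if s.1 then boolOf s.2.1 else s.2.2, fun x hx => if_neg hx, fun b₂ hb₂ y => ?_⟩
  obtain ⟨s, hs, hsB⟩ := hsyn y
  by_contra! hno
  -- Moving the base point to `x = s • y` in `B'` turns the period `γ` into its conjugate `c = s * γ
  -- * s⁻¹`.
  obtain ⟨x, hx⟩ : ∃ x, x = s • y := ⟨_, rfl⟩
  obtain ⟨c, hc⟩ : ∃ c, c = s * γ * s⁻¹ := ⟨_, rfl⟩
  have hcC : c ∈ C := by rw [hC, hc]; exact Finset.mem_image_of_mem _ hs
  rw [← hx] at hsB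
  have heq : ∀ q ∈ Q, b₂ (q • x) = b₂ ((q * c) • x) := by
    intro q hq
    have := hno (q * s) (Finset.mul_mem_mul hq hs)
    rw [hx, hc, ← mul_smul, ← mul_smul, this]
    simp [mul_assoc]
  have hown : ∀ i, b₁ (a i x • x) = φ x i := by
    intro i
    simp only [b₁, if_pos (haB i x)]
    have hiff : owned (a i x • x) ↔ φ x i = true := by
      constructor
      · rintro ⟨q, hq, j, h1, h2, h3⟩
        rw [← mul_smul] at h1 h2 h3
        have h4 := hsep x _ (hA2 q hq _ (haQ i x)) hsB h1
        rw [h4, one_smul] at h2 h3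
        have h5 : i = j := hainj i j x x (by rw [h2]; exact (inv_mul_eq_one.1 h4).symm)
        rwa [h5]
      · intro h
        exact ⟨a i x, haQ i x, i, by simpa using hsB, by simp, by simpa using h⟩
    by_cases h : φ x i = true
    · rw [h, boolOf_eq_true]; exact hiff.2 h
    · rw [Bool.eq_false_of_not_eq_true h, boolOf_eq_false]; exact fun h' => h (hiff.1 h')
  -- All the points `a i x * c • x` can only be owned by a single point `η • x` of `B'`: two
  -- candidates differ by a factor in `A`. If there is none, `η = 1` serves as a dummy.
  have hpartner : ∃ η, B' (η • x) ∧ (η = 1 ∨ η ∈ N) ∧ ∀ q ∈ Q, ∀ q' ∈ Q,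
      B' ((q⁻¹ * (q' * c)) • x) → q⁻¹ * (q' * c) = η := by
    by_cases h : ∃ q ∈ Q, ∃ q' ∈ Q, B' ((q⁻¹ * (q' * c)) • x)
    · obtain ⟨q₁, hq₁, q₂, hq₂, hB₁⟩ := h
      refine ⟨_, hB₁, Or.inr (by rw [← mul_assoc]; exact hNmem _ hq₁ _ hq₂ _ hcC),
        fun q hq q' hq' hB₂ => ?_⟩
      have := hsep _ _ (hA4 q hq q' hq' q₂ hq₂ q₁ hq₁) hB₁
        (by rw [← mul_smul]; simpa [mul_assoc] using hB₂)
      have e : q⁻¹ * (q' * c) = q⁻¹ * q' * (q₂⁻¹ * q₁) * (q₁⁻¹ * (q₂ * c)) := by group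
      rw [e, this, one_mul]
    · push Not at h
      exact ⟨1, by simpa using hsB, Or.inl rfl, fun q hq q' hq' hB₂ =>
        absurd hB₂ (h q hq q' hq')⟩
  obtain ⟨η, hηB, hηN, hηu⟩ := hpartner
  have hf : fail x c η (φ x) (φ (η • x)) := by
    intro i hi hi'
    rw [← hown i, ← hb₂ _ hi, heq _ (haQ i x), hb₂ _ hi']
    simp only [b₁, cell]
    split_ifs with hBi
    · congr 1
      rw [eq_iff_iff]
      constructor
      · rintro ⟨q, hq, j, h1, h2, h3⟩
        rw [← mul_smul] at h1 h2 h3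
        have h4 := hηu q hq _ (haQ i x) h1
        rw [h4] at h2 h3
        exact ⟨j, by rw [h2, ← h4]; group, h3⟩
      · rintro ⟨j, hj, h3⟩
        have e : (a j (η • x))⁻¹ • (a i x * c) • x = η • x := by
          rw [← hj, mul_smul, inv_smul_smul]
        exact ⟨a j (η • x), haQ _ _, j, by rwa [e], by rw [e], by rwa [e]⟩
    · rfl
  by_cases h1 : η = 1
  · subst h1
    rw [one_smul] at hf
    exact (hφx x hsB c hcC).1 hf
  · exact (hφx x hsB c hcC).2 η (hηN.resolve_left h1) h1 hηB hf

end Breaking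

/-! ### Topology of the shift and of its free part -/

section Shift

variable {Γ : Type u}

instance Shift.instCompactSpace (k : ℕ) : CompactSpace (Shift Γ k) :=
  inferInstanceAs (CompactSpace (Γ → Fin k))

instance Shift.instT2Space (k : ℕ) : T2Space (Shift Γ k) :=
  inferInstanceAs (T2Space (Γ → Fin k))

instance Shift.instTotallyDisconnectedSpace (k : ℕ) : TotallyDisconnectedSpace (Shift Γ k) :=
  inferInstanceAs (TotallyDisconnectedSpace (Γ → Fin k))

instance Shift.instSecondCountableTopology [Countable Γ] (k : ℕ) :
    SecondCountableTopology (Shift Γ k) :=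
  inferInstanceAs (SecondCountableTopology (Γ → Fin k))

theorem Shift.continuous_apply {k : ℕ} (δ : Γ) : Continuous fun x : Shift Γ k => x δ :=
  _root_.continuous_apply (A := fun _ : Γ => Fin k) δ

theorem Shift.continuous_of_apply {k : ℕ} {X : Type*} [TopologicalSpace X] {f : X → Shift Γ k}
    (h : ∀ δ, Continuous fun x => f x δ) : Continuous f :=
  continuous_pi (A := fun _ : Γ => Fin k) h

variable [Group Γ]

theorem Shift.smul_apply {k : ℕ} (γ δ : Γ) (x : Shift Γ k) : (γ • x) δ = x (δ * γ) := rfl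

instance Shift.instContinuousConstSMul (k : ℕ) : ContinuousConstSMul Γ (Shift Γ k) :=
  ⟨fun γ => Shift.continuous_of_apply fun δ => Shift.continuous_apply (δ * γ)⟩

instance FreePart.instSecondCountableTopology (X : Type v) [TopologicalSpace X]
    [SecondCountableTopology X] [MulAction Γ X] : SecondCountableTopology (FreePart Γ X) :=
  TopologicalSpace.Subtype.secondCountableTopology (FreePart Γ X : Set X)

instance FreePart.instContinuousConstSMul (X : Type v) [TopologicalSpace X] [MulAction Γ X]
    [ContinuousConstSMul Γ X] : ContinuousConstSMul Γ (FreePart Γ X) :=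
  ⟨fun γ => ((continuous_const_smul γ).comp continuous_subtype_val).subtype_mk _⟩

theorem zeroDimensional_freePart_shift (k : ℕ) : ZeroDimensional (FreePart Γ (Shift Γ k)) := by
  have h := (isTopologicalBasis_isClopen (X := Shift Γ k)).induced
    (Subtype.val : FreePart Γ (Shift Γ k) → Shift Γ k)
  refine TopologicalSpace.isTopologicalBasis_of_isOpen_of_nhds (fun U hU => hU.isOpen) ?_
  intro x U hx hU
  obtain ⟨_, ⟨V, hV, rfl⟩, hxV, hVU⟩ := h.exists_subset_of_mem_open hx hU
  exact ⟨_, hV.preimage continuous_subtype_val, hxV, hVU⟩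

theorem freeAction_freePart (X : Type v) [MulAction Γ X] : FreeAction Γ (FreePart Γ X) := by
  intro x
  rw [SubMulAction.stabilizer_of_subMul]
  exact x.2

end Shift

/-! ### Breaking finitely many periods, and passage from the free part to all spaces -/

section Aperiodic

variable {Γ : Type u} [Group Γ]

/-- There are finite sets that witness, uniformly over all free zero-dimensional spaces, that any
finitely many periods can be excluded by a continuous map to `{0, 1}`. -/
theorem exists_breaking_sets [Infinite Γ] (γ : ℕ → Γ) (hγ : ∀ s, γ s ≠ 1) :
    ∃ T : ℕ → Finset Γ, ∀ (X : Type v) [TopologicalSpace X]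
      [SecondCountableTopology X] [T2Space X] [MulAction Γ X] [ContinuousConstSMul Γ X],
      ZeroDimensional X → FreeAction Γ X → ∀ r, ∃ b : X → Bool, IsLocallyConstant b ∧
        ∀ s < r, ∀ x, ∃ t ∈ T s, b (t • x) ≠ b ((t * γ s) • x) := by
  classical
  choose E' T hE' hstep using fun (E : {E : Finset Γ // E.Nonempty}) (s : ℕ) =>
    exists_breaking_step.{u, v} E.1 E.2 (γ s) (hγ s)
  -- This recursion never sees `X`, which makes the witness sets `T (E s) s` uniform over all spaces
  -- and independent of `r`.
  let E : ℕ → {E : Finset Γ // E.Nonempty} := fun s =>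
    Nat.rec ⟨{1}, Finset.singleton_nonempty 1⟩ (fun s E => ⟨E' E s, hE' E s⟩) s
  refine ⟨fun s => T (E s) s, ?_⟩
  intro X _ _ _ _ _ hX hfree r
  have key : ∃ B : X → Prop, IsLocallyConstant B ∧ (∀ x, ∃ t ∈ (E r).1, B (t • x)) ∧
      ∃ b : X → Bool, IsLocallyConstant b ∧ ∀ b₂ : X → Bool, (∀ x, ¬ B x → b₂ x = b x) →
        ∀ s < r, ∀ x, ∃ t ∈ T (E s) s, b₂ (t • x) ≠ b₂ ((t * γ s) • x) := by
    induction r with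
    | zero =>
      exact ⟨fun _ => True, IsLocallyConstant.const _, fun x => ⟨1, by simp [E], trivial⟩,
        fun _ => true, IsLocallyConstant.const _, fun _ _ s hs => absurd hs (Nat.not_lt_zero s)⟩
    | succ r ih =>
      obtain ⟨B, hB, hBE, b, hb, h⟩ := ih
      obtain ⟨B', hB', hBB, hBE', b₁, hb₁, hbb, h'⟩ := hstep (E r) r X hX hfree B hB hBE b hb
      refine ⟨B', hB', hBE', b₁, hb₁, fun b₂ hb₂ s hs => ?_⟩
      rcases Nat.lt_succ_iff_lt_or_eq.1 hs with hs | rfl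
      · refine h b₂ (fun x hx => ?_) s hs
        rw [hb₂ x fun hx' => hx (hBB x hx'), hbb x hx]
      · exact h' b₂ hb₂
  obtain ⟨B, -, -, b, hb, h⟩ := key
  exact ⟨b, hb, h b fun _ _ => rfl⟩

theorem hasContinuousAvoidingColoring_of_freePart [Countable Γ] [Infinite Γ] {k : ℕ} (hk : 1 ≤ k)
    {P : Set (Pattern Γ k)} (hP : P.Finite)
    (h : HasContinuousAvoidingColoring P (FreePart Γ (Shift Γ 2)))
    (X : Type v) [TopologicalSpace X] [SecondCountableTopology X] [T2Space X] [MulAction Γ X]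
    [ContinuousConstSMul Γ X] (hX : ZeroDimensional X) (hfree : FreeAction Γ X) :
    HasContinuousAvoidingColoring P X := by
  classical
  obtain ⟨f, hf, hfP⟩ := h
  obtain ⟨γ₀, hγ₀⟩ := exists_ne (1 : Γ)
  have : Nonempty {γ : Γ // γ ≠ 1} := ⟨⟨γ₀, hγ₀⟩⟩
  obtain ⟨e, he⟩ := exists_surjective_nat {γ : Γ // γ ≠ 1}
  obtain ⟨T, hT⟩ := exists_breaking_sets.{u, v} (fun s => (e s : Γ)) fun s => (e s).2
  -- Closed because `T s` is finite; a point in all `Z' s` has no nontrivial period.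
  let Z' : ℕ → Set (Shift Γ 2) := fun s =>
    {z | ∀ δ : Γ, ∃ t ∈ T s, z (t * δ) ≠ z (t * e s * δ)}
  have hZ' : ∀ s, IsClosed (Z' s) := by
    intro s
    have : Z' s = ⋂ δ : Γ, ⋃ t ∈ T s, {z | z (t * δ) ≠ z (t * e s * δ)} := by
      ext z; simp [Z']
    rw [this]
    refine isClosed_iInter fun δ => Set.Finite.isClosed_biUnion (T s).finite_toSet fun t _ => ?_
    have hc : Continuous fun z : Shift Γ 2 => (z (t * δ), z (t * e s * δ)) :=
      (Shift.continuous_apply _).prodMk (Shift.continuous_apply _)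
    exact (isClosed_discrete {p : Fin 2 × Fin 2 | p.1 ≠ p.2}).preimage hc
  let Z : ℕ → Set (Shift Γ 2) := fun r => ⋂ s : Fin r, Z' s
  have hZ : ∀ r, IsClosed (Z r) := fun r => isClosed_iInter fun s => hZ' s
  have hZanti : Antitone Z := fun r r' hr z hz => Set.mem_iInter.2 fun s =>
    Set.mem_iInter.1 hz ⟨s, s.2.trans_le hr⟩
  have hmem : ∀ z ∈ ⋂ r, Z r, ∀ s, z ∈ Z' s := fun z hz s =>
    Set.mem_iInter.1 (Set.mem_iInter.1 hz (s + 1)) ⟨s, Nat.lt_succ_self s⟩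
  have hZfree : ∀ z ∈ ⋂ r, Z r, z ∈ FreePart Γ (Shift Γ 2) := by
    intro z hz
    refine (Subgroup.eq_bot_iff_forall _).2 fun γ hγ => ?_
    by_contra h1
    obtain ⟨s, hs⟩ := he ⟨γ, h1⟩
    obtain ⟨t, -, ht⟩ := hmem z hz s 1
    refine ht ?_
    have : (γ • z) t = z t := congrFun (hγ : γ • z = z) t
    rw [Shift.smul_apply] at this
    simp [hs, this]
  have hZsmul : ∀ (γ : Γ), ∀ z ∈ ⋂ r, Z r, γ • z ∈ ⋂ r, Z r := by
    intro γ z hz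
    refine Set.mem_iInter.2 fun r => Set.mem_iInter.2 fun s δ => ?_
    obtain ⟨t, ht, hne⟩ := hmem z hz s (δ * γ)
    refine ⟨t, ht, ?_⟩
    rw [Shift.smul_apply, Shift.smul_apply]
    simpa only [mul_assoc] using hne
  have hZc : IsClosed (⋂ r, Z r) := isClosed_iInter hZ
  have : CompactSpace (⋂ r, Z r : Set (Shift Γ 2)) := isCompact_iff_compactSpace.1 hZc.isCompact
  let g : (⋂ r, Z r : Set (Shift Γ 2)) → Fin k := fun z => f ⟨z, hZfree z z.2⟩
  have hg : Continuous g := hf.comp (continuous_subtype_val.subtype_mk _)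
  have : Nonempty (Fin k) := ⟨⟨0, hk⟩⟩
  -- Continuous extension of the coloring from the closed subshift to the whole shift; the lifting
  -- result is used over a one-point base.
  obtain ⟨F, hF, -, hFg⟩ := Profinite.exists_lift_of_finite_of_injective_of_surjective
    (T := Unit) (Subtype.val : (⋂ r, Z r : Set (Shift Γ 2)) → _) continuous_subtype_val
    Subtype.val_injective (fun _ : Fin k => ()) (fun _ => ⟨Classical.arbitrary _, rfl⟩) g hg
    (fun _ => ()) continuous_const rfl
  let bad : Set (Shift Γ 2) := ⋃ p ∈ P, {z | ∀ γ : p.dom, F ((γ : Γ) • z) = p.val γ}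
  have hbad : IsClosed bad := by
    refine hP.isClosed_biUnion fun p _ => ?_
    simp only [Set.ofPred_forall]
    refine isClosed_iInter fun γ => ?_
    exact (isClosed_discrete {p.val γ}).preimage (hF.comp (continuous_const_smul (γ : Γ)))
  have hdisj : bad ∩ ⋂ r, Z r = ∅ := by
    refine Set.eq_empty_iff_forall_notMem.2 fun z ⟨hzb, hz⟩ => ?_
    simp only [bad, Set.mem_iUnion] at hzb
    obtain ⟨p, hp, hz'⟩ := hzb
    refine hfP p hp ⟨⟨z, hZfree z hz⟩, fun γ => ?_⟩
    rw [← hz' γ]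
    exact (congrFun hFg ⟨(γ : Γ) • z, hZsmul γ z hz⟩).symm
  -- Occurrence of a pattern of `P` in `F` is a closed condition, so by compactness finitely many
  -- broken periods already exclude it.
  obtain ⟨r, hr⟩ := hbad.isCompact.elim_directed_family_closed Z hZ hdisj
    (hZanti.directed_ge)
  obtain ⟨b, hb, hbT⟩ := hT X hX hfree r
  let π : X → Shift Γ 2 := fun x δ => if b (δ • x) then 1 else 0
  have hπ : Continuous π := Shift.continuous_of_apply fun δ =>
    ((isLocallyConstant_const_smul hb δ).comp fun s : Bool => if s then (1 : Fin 2) else 0).continuous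
  have hπsmul : ∀ (γ : Γ) x, π (γ • x) = γ • π x := by
    intro γ x
    funext δ
    rw [Shift.smul_apply]
    simp [π, mul_smul]
  have hπZ : ∀ x, π x ∈ Z r := by
    refine fun x => Set.mem_iInter.2 fun s δ => ?_
    obtain ⟨t, ht, hne⟩ := hbT s s.2 (δ • x)
    refine ⟨t, ht, fun heq => hne ?_⟩
    simp only [π, mul_smul] at heq ⊢
    revert heq
    cases b (t • δ • x) <;> cases b (t • (e s : Γ) • δ • x) <;> simp
  refine ⟨F ∘ π, hF.comp hπ, fun p hp ⟨x, hx⟩ => ?_⟩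
  refine Set.eq_empty_iff_forall_notMem.1 hr (π x) ⟨?_, hπZ x⟩
  refine Set.mem_biUnion hp fun γ => ?_
  rw [← hx γ, ← hπsmul]
  rfl

end Aperiodic

/-! ### From colorings of `H_{D,n}` to colorings of spaces -/

section Tiles

variable {Γ : Type u} [Group Γ] [DecidableEq Γ]

/-- A continuous `n`-coloring that is injective on each `D • x` yields a locally constant map `q` to
the vertices of `H_{D,n}`. Along an orbit `q` respects labeled edges, so an occurrence in `f ∘ q`
gives one in `f`. -/
theorem hasContinuousAvoidingColoring_of_tileGraph {k : ℕ} {P : Set (Pattern Γ k)}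
    {S D : Finset Γ} {n : ℕ} (hD : S ∪ S⁻¹ ∪ {1} ⊆ D) (hn : D.card ^ 2 ≤ n)
    (h : (tileGraph S D n hD).HasAvoidingColoring P)
    (X : Type v) [TopologicalSpace X] [SecondCountableTopology X] [T2Space X] [MulAction Γ X]
    [ContinuousConstSMul Γ X] (hX : ZeroDimensional X) (hfree : FreeAction Γ X) :
    HasContinuousAvoidingColoring P X := by
  obtain ⟨f, hf⟩ := h
  have h1 : (1 : Γ) ∈ D := hD (by simp)
  have hmem : ∀ δ ∈ D, ∀ δ' ∈ D, δ * δ'⁻¹ ∈ D * D⁻¹ := fun δ hδ δ' hδ' =>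
    Finset.mul_mem_mul hδ (Finset.inv_mem_inv hδ')
  have hsub : D ⊆ D * D⁻¹ := fun δ hδ => by simpa using hmem δ hδ 1 h1
  have hcard : ((D * D⁻¹).erase 1).card < n := by
    refine (Finset.card_erase_lt_of_mem (hsub h1)).trans_le (Finset.card_mul_le.trans ?_)
    rwa [Finset.card_inv, ← sq]
  obtain ⟨c, hc, hcD⟩ := exists_proper_coloring hX hfree (D * D⁻¹) (by
    intro γ hγ
    have := Finset.inv_mem_inv hγ
    simpa using this) n hcard
  have hinj : ∀ x, Function.Injective fun δ : D => c ((δ : Γ) • x) := by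
    intro x δ δ' heq
    by_contra hne
    refine hcD ((δ' : Γ) • x) (δ * (δ' : Γ)⁻¹) (hmem _ δ.2 _ δ'.2) ?_ ?_
    · exact fun h => hne (Subtype.ext (mul_inv_eq_one.1 h))
    · rw [← mul_smul]
      simpa using heq
  let q : X → D ↪ Fin n := fun x => ⟨_, hinj x⟩
  have hq : IsLocallyConstant q := by
    have h2 : IsLocallyConstant fun x => (fun δ : D => c ((δ : Γ) • x)) :=
      isLocallyConstant_pi fun δ => isLocallyConstant_const_smul hc (δ : Γ)
    refine (IsLocallyConstant.iff_eventually_eq _).2 fun x => ?_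
    filter_upwards [(IsLocallyConstant.iff_eventually_eq _).1 h2 x] with y hy
    exact DFunLike.coe_injective hy
  refine ⟨f ∘ q, (hq.comp f).continuous, fun p hp ⟨x, hx⟩ => hf p hp ⟨fun γ => q ((γ : Γ) • x), ?_, hx⟩⟩
  rintro γ γ' ⟨hne, σ, hσ, hγσ⟩
  have hγσ : (γ' : Γ) = σ * γ := hγσ
  have hcomp : Compatible σ (q ((γ : Γ) • x)) (q ((γ' : Γ) • x)) := by
    intro δ δ' hδ
    simp only [q, Function.Embedding.coeFn_mk]
    rw [hδ, hγσ]
    simp only [mul_smul]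
  refine ⟨⟨fun heq => ?_, σ, hσ, hcomp⟩, ?_⟩
  · have := DFunLike.congr_fun heq ⟨1, h1⟩
    simp only [q, Function.Embedding.coeFn_mk, one_smul] at this
    refine hcD ((γ : Γ) • x) σ (hsub (hD (Finset.mem_union_left _ hσ))) ?_ ?_
    · rintro rfl
      rw [one_mul] at hγσ
      exact hne hγσ.symm
    · rw [← mul_smul, ← hγσ, this]
  · refine (tileLabel_eq hD hσ hcomp).trans ?_
    change σ = (γ' : Γ) * (γ : Γ)⁻¹
    rw [hγσ, mul_inv_cancel_right]

end Tiles

/-! ### The iterated logarithm and existence of admissible sequences -/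

section LogStar

/-- Iterated powers of two. -/
def tower : ℕ → ℕ
  | 0 => 1
  | t + 1 => 2 ^ tower t

theorem lt_tower (t : ℕ) : t < tower t := by
  induction t with
  | zero => simp [tower]
  | succ t ih =>
    have : tower t < 2 ^ tower t := Nat.lt_two_pow_self
    simp only [tower]
    omega

theorem iterate_logb_le_tower (t m : ℕ) (x : ℝ) (h : ∀ s < t, 1 < (Real.logb 2)^[s] x)
    (hx : x ≤ tower (t + m)) : (Real.logb 2)^[t] x ≤ tower m := by
  induction t generalizing x with
  | zero => simpa using hx
  | succ t ih =>
    rw [Function.iterate_succ_apply]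
    refine ih _ (fun s hs => ?_) ?_
    · have := h (s + 1) (by omega)
      rwa [Function.iterate_succ_apply] at this
    · have hx1 : 1 < x := h 0 (by omega)
      rw [show t + 1 + m = (t + m) + 1 by omega] at hx
      simp only [tower, Nat.cast_pow, Nat.cast_ofNat] at hx
      rw [Real.logb_le_iff_le_rpow (by norm_num) (by linarith), Real.rpow_natCast]
      exact hx

theorem le_tower_of_iterate_logb_le_one (t : ℕ) (x : ℝ) (h : ∀ s < t, 1 < (Real.logb 2)^[s] x)
    (hx : (Real.logb 2)^[t] x ≤ 1) : x ≤ tower t := by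
  induction t generalizing x with
  | zero => simpa [tower] using hx
  | succ t ih =>
    rw [Function.iterate_succ_apply] at hx
    have h1 := ih _ (fun s hs => by
      have := h (s + 1) (by omega)
      rwa [Function.iterate_succ_apply] at this) hx
    have hx1 : 1 < x := h 0 (by omega)
    rw [Real.logb_le_iff_le_rpow (by norm_num) (by linarith), Real.rpow_natCast] at h1
    simpa [tower] using h1

theorem exists_iterate_logb_le_one {n t : ℕ} (hn : n ≤ tower t) :
    ∃ s ≤ t, (Real.logb 2)^[s] (n : ℝ) ≤ 1 := by
  by_contra! h
  have := iterate_logb_le_tower t 0 n (fun s hs => h s hs.le) (by simpa using hn)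
  simp only [tower, Nat.cast_one] at this
  exact absurd this (not_le.2 (h t le_rfl))

theorem le_tower_logStar (n : ℕ) : n ≤ tower (logStar n) := by
  obtain ⟨s, -, hs⟩ := exists_iterate_logb_le_one (lt_tower n).le
  have hmem : logStar n ∈ {t : ℕ | (Real.logb 2)^[t] (n : ℝ) ≤ 1} := Nat.sInf_mem ⟨s, hs⟩
  have := le_tower_of_iterate_logb_le_one (logStar n) n
    (fun s hs => not_le.1 (Nat.notMem_of_lt_sInf hs)) hmem
  exact_mod_cast this

theorem logStar_le_of_le_tower {n t : ℕ} (hn : n ≤ tower t) : logStar n ≤ t := by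
  obtain ⟨s, hst, hs⟩ := exists_iterate_logb_le_one hn
  exact (Nat.sInf_le hs).trans hst

/-- Along `n = tower (l + 2)` the exponent is at most `2 * (l + 2)`, linear in `l`, while `n` is at
least doubly exponential in `l`. -/
theorem exists_pow_logStar_le (c : ℕ) (hc : 1 ≤ c) : ∃ n, 2 ≤ n ∧ c ^ (2 * logStar n) ≤ n := by
  obtain ⟨l, hl, h⟩ := exists_mul_pow_lt_two_pow (6 * c)
  refine ⟨tower (l + 2), ?_, ?_⟩
  · have := lt_tower (l + 2)
    omega
  calc c ^ (2 * logStar (tower (l + 2))) ≤ c ^ (2 * (l + 2)) :=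
        Nat.pow_le_pow_right hc (Nat.mul_le_mul_left _ (logStar_le_of_le_tower le_rfl))
    _ ≤ (2 ^ c) ^ (2 * (l + 2)) := Nat.pow_le_pow_left Nat.lt_two_pow_self.le _
    _ = 2 ^ (c * (2 * (l + 2))) := by rw [← pow_mul]
    _ ≤ 2 ^ (2 ^ tower l) := by
        refine Nat.pow_le_pow_right (by norm_num) ?_
        have h1 : l ≤ l ^ 10 := Nat.le_self_pow (by norm_num) l
        have h2 : 2 ^ l ≤ 2 ^ tower l := Nat.pow_le_pow_right (by norm_num) (lt_tower l).le
        have h3 : c * (2 * (l + 2)) ≤ 6 * c * l ^ 10 := by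
          calc c * (2 * (l + 2)) ≤ c * (6 * l) := Nat.mul_le_mul_left _ (by omega)
            _ = 6 * c * l := by ring
            _ ≤ 6 * c * l ^ 10 := Nat.mul_le_mul_left _ h1
        omega
    _ = tower (l + 2) := rfl

theorem exists_isTileSequence {Γ : Type u} [Group Γ] [DecidableEq Γ] [Countable Γ] [Infinite Γ]
    (S : Finset Γ) : ∃ (F : ℕ → Finset Γ) (n : ℕ → ℕ), IsTileSequence S F n := by
  obtain ⟨hden⟩ := nonempty_denumerable Γ
  let e : ℕ ≃ Γ := (Denumerable.eqv Γ).symm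
  -- The offset places `S ∪ S⁻¹ ∪ {1}` inside `F 0`.
  let N : ℕ := (S ∪ S⁻¹ ∪ {1}).sup e.symm + 1
  let F : ℕ → Finset Γ := fun i => (Finset.range (N + i)).map e.toEmbedding
  have hmem : ∀ i γ, γ ∈ F i ↔ e.symm γ < N + i := by
    intro i γ
    simp only [F, Finset.mem_map, Finset.mem_range, Equiv.coe_toEmbedding]
    constructor
    · rintro ⟨a, ha, rfl⟩
      simpa using ha
    · exact fun h => ⟨e.symm γ, h, by simp⟩
  have hbase : ∀ i, S ∪ S⁻¹ ∪ {1} ⊆ F i := by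
    intro i γ hγ
    rw [hmem]
    have : e.symm γ ≤ (S ∪ S⁻¹ ∪ {1}).sup e.symm := Finset.le_sup hγ
    omega
  have h1 : ∀ i, (1 : Γ) ∈ F i := fun i => hbase i (by simp)
  choose n hn2 hn using fun i => exists_pow_logStar_le (F i).card (Finset.card_pos.2 ⟨1, h1 i⟩)
  refine ⟨F, n, hbase 0, strictMono_nat_of_lt_succ fun i => ?_, fun γ => ⟨e.symm γ + 1, ?_⟩,
    fun i => by have := hn2 i; omega, hn, fun i => (hbase i).trans ?_⟩
  · refine Finset.map_ssubset_map.2 (Finset.ssubset_iff_subset_ne.2 ⟨?_, ?_⟩)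
    · exact Finset.range_subset_range.2 (by omega)
    · intro h
      have := congrArg Finset.card h
      simp at this
  · rw [hmem]; omega
  · have hT : logStar (n i) ≠ 0 := by
      intro h0
      have h3 := le_tower_logStar (n i)
      have h4 := hn2 i
      rw [h0] at h3
      simp only [tower] at h3
      omega
    exact Finset.subset_pow (h1 i) hT

end LogStar

/-! ### Cole–Vishkin color reduction -/

section ColeVishkin

/-- The least position in which the binary expansions of two numbers differ. -/
noncomputable def bitDiff (a b : ℕ) : ℕ := sInf {i | a.testBit i ≠ b.testBit i}

theorem testBit_bitDiff {a b : ℕ} (h : a ≠ b) :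
    a.testBit (bitDiff a b) ≠ b.testBit (bitDiff a b) := by
  have : {i | a.testBit i ≠ b.testBit i}.Nonempty := by
    by_contra! h'
    refine h (Nat.eq_of_testBit_eq fun i => ?_)
    by_contra hi
    exact Set.eq_empty_iff_forall_notMem.1 h' i hi
  exact Nat.sInf_mem this

theorem bitDiff_lt {a b l : ℕ} (h : a ≠ b) (ha : a < 2 ^ l) (hb : b < 2 ^ l) :
    bitDiff a b < l := by
  by_contra! hl
  refine testBit_bitDiff h ?_
  have hp : 2 ^ l ≤ 2 ^ bitDiff a b := Nat.pow_le_pow_right (by norm_num) hl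
  rw [Nat.testBit_lt_two_pow (ha.trans_le hp), Nat.testBit_lt_two_pow (hb.trans_le hp)]

variable {Γ : Type u} [Group Γ]

/-- One round of the Cole–Vishkin color reduction along the translation by `γ`. -/
noncomputable def colorReduction (γ : Γ) (c : Γ → ℕ) (x : Γ) : ℕ :=
  2 * bitDiff (c x) (c (γ * x)) + ((c x).testBit (bitDiff (c x) (c (γ * x)))).toNat

/-- Equal new colors would encode the same position and the same bit, but the old colors of `x` and
`γ * x` differ at the position recorded by `x`. -/
theorem colorReduction_ne {γ : Γ} {c : Γ → ℕ} (hc : ∀ x, c (γ * x) ≠ c x) (x : Γ) :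
    colorReduction γ c (γ * x) ≠ colorReduction γ c x := by
  intro h
  have h1 := testBit_bitDiff (hc x).symm
  unfold colorReduction at h
  have h2 := Bool.toNat_le ((c (γ * x)).testBit (bitDiff (c (γ * x)) (c (γ * (γ * x)))))
  have h3 := Bool.toNat_le ((c x).testBit (bitDiff (c x) (c (γ * x))))
  have h4 : bitDiff (c (γ * x)) (c (γ * (γ * x))) = bitDiff (c x) (c (γ * x)) := by omega
  rw [h4] at h
  have h5 : ((c (γ * x)).testBit (bitDiff (c x) (c (γ * x)))).toNat =
      ((c x).testBit (bitDiff (c x) (c (γ * x)))).toNat := by omega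
  revert h1 h5
  cases (c (γ * x)).testBit (bitDiff (c x) (c (γ * x))) <;>
    cases (c x).testBit (bitDiff (c x) (c (γ * x))) <;> simp

theorem colorReduction_lt {γ : Γ} {c : Γ → ℕ} (hc : ∀ x, c (γ * x) ≠ c x) {l : ℕ}
    (hl : ∀ x, c x < 2 ^ l) (x : Γ) : colorReduction γ c x < 2 * l := by
  have h1 := bitDiff_lt (hc x).symm (hl x) (hl _)
  have h2 := Bool.toNat_le ((c x).testBit (bitDiff (c x) (c (γ * x))))
  unfold colorReduction
  omega

/-- Each round looks one step further along the `γ`-orbit. -/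
theorem iterate_colorReduction_congr {γ : Γ} (t : ℕ) {c c' : Γ → ℕ} {x x' : Γ}
    (h : ∀ a ≤ t, c (γ ^ a * x) = c' (γ ^ a * x')) :
    (colorReduction γ)^[t] c x = (colorReduction γ)^[t] c' x' := by
  induction t generalizing c c' with
  | zero => simpa using h 0 le_rfl
  | succ t ih =>
    rw [Function.iterate_succ_apply, Function.iterate_succ_apply]
    refine ih fun a ha => ?_
    have h1 := h a (by omega)
    have h2 := h (a + 1) (by omega)
    rw [pow_succ', mul_assoc, mul_assoc] at h2
    unfold colorReduction
    rw [h1, h2]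

/-- Half the number of colors that `t` rounds of color reduction bring down to six. -/
def halfPalette : ℕ → ℕ
  | 0 => 3
  | t + 1 => 2 ^ (halfPalette t - 1)

theorem tower_add_two_le_halfPalette (t : ℕ) : tower t + 2 ≤ halfPalette t := by
  induction t with
  | zero => simp [tower, halfPalette]
  | succ t ih =>
    have h1 : 2 ^ (tower t + 1) ≤ 2 ^ (halfPalette t - 1) :=
      Nat.pow_le_pow_right (by norm_num) (by omega)
    have h2 : 2 ^ (tower t + 1) = 2 * 2 ^ tower t := by ring
    have h3 : tower t < 2 ^ tower t := Nat.lt_two_pow_self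
    have h4 := lt_tower t
    simp only [tower, halfPalette]
    omega

/-- A round turns `2 ^ l` colors into `2 * l`, and `2 * halfPalette (t + 1) = 2 ^ halfPalette t`. -/
theorem iterate_colorReduction {γ : Γ} (t : ℕ) {c : Γ → ℕ} (hc : ∀ x, c (γ * x) ≠ c x)
    (hlt : ∀ x, c x < 2 * halfPalette t) :
    (∀ x, (colorReduction γ)^[t] c (γ * x) ≠ (colorReduction γ)^[t] c x) ∧
      ∀ x, (colorReduction γ)^[t] c x < 6 := by
  induction t generalizing c with
  | zero => exact ⟨hc, hlt⟩
  | succ t ih =>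
    rw [Function.iterate_succ_apply]
    refine ih (colorReduction_ne hc) (colorReduction_lt hc fun x => ?_)
    have h1 := tower_add_two_le_halfPalette t
    have h2 := hlt x
    rw [halfPalette, ← pow_succ', show halfPalette t - 1 + 1 = halfPalette t by omega] at h2
    exact h2

end ColeVishkin

/-! ### The compact free space of families of `6`-colorings -/

section ColoringSpace

variable {Γ : Type u} [Group Γ]

/-- The compact space of families of `6`-colorings of `Γ`, one for each `γ ≠ 1`, that are proper
with respect to the translation by `γ`. -/
abbrev ColoringSpace (Γ : Type u) [Group Γ] : Type u :=
  {y : {γ : Γ // γ ≠ 1} × Γ → Fin 6 // ∀ γ δ, y (γ, γ * δ) ≠ y (γ, δ)}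

namespace ColoringSpace

theorem isClosed_range : IsClosed
    {y : {γ : Γ // γ ≠ 1} × Γ → Fin 6 | ∀ γ δ, y (γ, γ * δ) ≠ y (γ, δ)} := by
  simp only [Set.ofPred_forall]
  refine isClosed_iInter fun γ => isClosed_iInter fun δ => ?_
  have hc : Continuous fun y : {γ : Γ // γ ≠ 1} × Γ → Fin 6 => (y (γ, γ * δ), y (γ, δ)) :=
    (continuous_apply _).prodMk (continuous_apply _)
  exact (isClosed_discrete {p : Fin 6 × Fin 6 | p.1 ≠ p.2}).preimage hc

instance : CompactSpace (ColoringSpace Γ) := isCompact_iff_compactSpace.1 isClosed_range.isCompact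

instance [Countable Γ] : PolishSpace (ColoringSpace Γ) :=
  have : PolishSpace (Fin 6) := inferInstance
  isClosed_range.polishSpace

theorem zeroDimensional : ZeroDimensional (ColoringSpace Γ) := isTopologicalBasis_isClopen

instance : MulAction Γ (ColoringSpace Γ) where
  smul η y := ⟨fun w => y.1 (w.1, w.2 * η), fun γ δ => by
    change y.1 (γ, γ * δ * η) ≠ y.1 (γ, δ * η)
    rw [mul_assoc]
    exact y.2 γ (δ * η)⟩
  one_smul y := Subtype.ext (funext fun w => by
    change y.1 (w.1, w.2 * 1) = y.1 w
    rw [mul_one])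
  mul_smul η η' y := Subtype.ext (funext fun w => by
    change y.1 (w.1, w.2 * (η * η')) = y.1 (w.1, w.2 * η * η')
    rw [mul_assoc])

theorem smul_apply (η : Γ) (y : ColoringSpace Γ) (w : {γ : Γ // γ ≠ 1} × Γ) :
    (η • y).1 w = y.1 (w.1, w.2 * η) := rfl

instance : ContinuousConstSMul Γ (ColoringSpace Γ) :=
  ⟨fun η => Continuous.subtype_mk (continuous_pi fun w =>
    (continuous_apply (w.1, w.2 * η)).comp continuous_subtype_val) _⟩

theorem freeAction : FreeAction Γ (ColoringSpace Γ) := by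
  intro y
  refine (Subgroup.eq_bot_iff_forall _).2 fun η hη => ?_
  by_contra h1
  have h2 : (η • y).1 (⟨η, h1⟩, 1) = y.1 (⟨η, h1⟩, 1) := by rw [(hη : η • y = y)]
  rw [smul_apply, one_mul] at h2
  have h3 := y.2 ⟨η, h1⟩ 1
  rw [mul_one] at h3
  exact h3 h2

/-- A continuous coloring of the compact space depends on finitely many coordinates only. -/
theorem exists_window {k : ℕ} {f : ColoringSpace Γ → Fin k} (hf : Continuous f) :
    ∃ W : Finset ({γ : Γ // γ ≠ 1} × Γ), ∀ y y' : ColoringSpace Γ,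
      (∀ w ∈ W, y.1 w = y'.1 w) → f y = f y' := by
  classical
  have key : ∀ y : ColoringSpace Γ, ∃ I : Finset ({γ : Γ // γ ≠ 1} × Γ),
      ∀ y' : ColoringSpace Γ, (∀ w ∈ I, y'.1 w = y.1 w) → f y' = f y := by
    intro y
    obtain ⟨O, hO, hOf⟩ := isOpen_induced_iff.1 ((isOpen_discrete {f y}).preimage hf)
    have hy : y.1 ∈ O := by
      have : y ∈ f ⁻¹' {f y} := rfl
      rwa [← hOf] at this
    obtain ⟨I, U, hU, hIU⟩ := isOpen_pi_iff.1 hO y.1 hy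
    refine ⟨I, fun y' h => ?_⟩
    have : y' ∈ f ⁻¹' {f y} := by
      rw [← hOf]
      exact hIU fun w hw => by rw [h w hw]; exact (hU w hw).2
    exact this
  choose I hI using key
  have hopen : ∀ y : ColoringSpace Γ, IsOpen {y' : ColoringSpace Γ | ∀ w ∈ I y, y'.1 w = y.1 w} := by
    intro y
    have : {y' : ColoringSpace Γ | ∀ w ∈ I y, y'.1 w = y.1 w} =
        ⋂ w ∈ I y, {y' : ColoringSpace Γ | y'.1 w = y.1 w} := by ext; simp
    rw [this]
    refine isOpen_biInter_finset fun w _ => ?_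
    have hc : Continuous fun y' : ColoringSpace Γ => y'.1 w :=
      (continuous_apply w).comp continuous_subtype_val
    exact (isOpen_discrete {y.1 w}).preimage hc
  obtain ⟨s, hs⟩ := isCompact_univ.elim_finite_subcover _ hopen
    fun y _ => Set.mem_iUnion.2 ⟨y, fun _ _ => rfl⟩
  refine ⟨s.biUnion I, fun y y' h => ?_⟩
  obtain ⟨z, hz, hyz⟩ := Set.mem_iUnion₂.1 (hs (Set.mem_univ y))
  rw [hI z y hyz, hI z y' fun w hw => ?_]
  rw [← h w (Finset.mem_biUnion.2 ⟨z, hz, hw⟩), hyz w hw]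

end ColoringSpace

/-- Greedy coloring applied to `Γ` as a discrete space acting on itself: each point has at most two
neighbors. -/
theorem exists_three_coloring [Countable Γ] (γ : Γ) (hγ : γ ≠ 1) :
    ∃ c : Γ → Fin 3, ∀ x, c (γ * x) ≠ c x := by
  classical
  let _ : TopologicalSpace Γ := ⊥
  have : DiscreteTopology Γ := ⟨rfl⟩
  have : ContinuousConstSMul Γ Γ := ⟨fun _ => continuous_of_discreteTopology⟩
  have h0 : ZeroDimensional Γ :=
    TopologicalSpace.isTopologicalBasis_of_isOpen_of_nhds (fun U hU => hU.isOpen)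
      fun x U hx _ => ⟨U, isClopen_discrete U, hx, subset_rfl⟩
  have hfree : FreeAction Γ Γ := fun x => (Subgroup.eq_bot_iff_forall _).2 fun η hη => by
    have : η * x = x := hη
    simpa using this
  obtain ⟨c, -, hc⟩ := exists_proper_coloring h0 hfree {γ, γ⁻¹} (by simp) 3
    ((Finset.card_le_card (Finset.erase_subset _ _)).trans_lt
      ((Finset.card_le_two).trans_lt (by norm_num)))
  exact ⟨c, fun x => hc x γ (by simp) hγ⟩

end ColoringSpace

/-! ### From colorings of spaces to colorings of `H_{D,n}` -/

section TilesOfSpaces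

variable {Γ : Type u} [Group Γ] [DecidableEq Γ]

theorem Pattern.SConnected.eq_of_forall_adj {k : ℕ} {S : Finset Γ} {p : Pattern Γ k}
    (hp : p.SConnected S) {α : Type*} (ψ : p.dom → α)
    (h : ∀ a b, ((cayleyGraph S).induce (p.dom : Set Γ)).graph.Adj a b → ψ a = ψ b)
    (a b : p.dom) : ψ a = ψ b := by
  obtain ⟨w⟩ := hp.preconnected a b
  induction w with
  | nil => rfl
  | cons hadj _ ih => exact (h _ _ hadj).trans ih

theorem tileGraph_hasAvoidingColoring_of_window [Countable Γ] {k : ℕ} (hk : 1 ≤ k)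
    {P : Set (Pattern Γ k)} {S D : Finset Γ} (hPS : ∀ p ∈ P, p.SConnected S)
    {f : ColoringSpace Γ → Fin k} (hfP : ∀ p ∈ P, ¬ p.Occurs f)
    {W : Finset ({γ : Γ // γ ≠ 1} × Γ)}
    (hW : ∀ y y' : ColoringSpace Γ, (∀ w ∈ W, y.1 w = y'.1 w) → f y = f y')
    {n T : ℕ} (hD : S ∪ S⁻¹ ∪ {1} ⊆ D) (hn : n ≤ tower T)
    (hDW : ∀ p ∈ P, ∀ w ∈ W, ∀ η ∈ p.dom, ∀ η' ∈ p.dom, ∀ a ≤ T,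
      (w.1 : Γ) ^ a * w.2 * η * η'⁻¹ ∈ D) :
    (tileGraph S D n hD).HasAvoidingColoring P := by
  classical
  let ext : (D ↪ Fin n) → Γ → ℕ := fun q x => if h : x ∈ D then (q ⟨x, h⟩ : ℕ) else 0
  let match_ : (D ↪ Fin n) → ColoringSpace Γ → Prop := fun q y =>
    ∀ w ∈ W, (y.1 w : ℕ) = (colorReduction (w.1 : Γ))^[T] (ext q) w.2
  -- The default color is harmless: every vertex in an occurrence will turn out to match a point.
  let F : (D ↪ Fin n) → Fin k := fun q =>
    if h : ∃ y, match_ q y then f h.choose else ⟨0, hk⟩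
  have hF : ∀ q y, match_ q y → F q = f y := by
    intro q y hy
    have h : ∃ y, match_ q y := ⟨y, hy⟩
    simp only [F, dif_pos h]
    exact hW _ _ fun w hw => Fin.ext ((h.choose_spec w hw).trans (hy w hw).symm)
  refine ⟨F, fun p hp ⟨φ, hφ, hφp⟩ => ?_⟩
  obtain ⟨η₀⟩ := (hPS p hp).nonempty
  -- Place the tile `φ η` at `η`, so that it covers `D * η`. On the common part `U` adjacent tiles
  -- agree, hence all do, as the pattern is connected.
  let U : Set Γ := {u | ∀ η ∈ p.dom, u * η⁻¹ ∈ D}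
  have hU : ∀ u ∈ U, ∀ η : p.dom,
      ext (φ η) (u * (η : Γ)⁻¹) = ext (φ η₀) (u * (η₀ : Γ)⁻¹) := by
    intro u hu η
    refine (hPS p hp).eq_of_forall_adj (fun η : p.dom => ext (φ η) (u * (η : Γ)⁻¹)) ?_ η η₀
    intro a b hab
    obtain ⟨⟨-, σ, hσ, hcomp⟩, hlab⟩ := hφ a b hab
    have hlab' : tileLabel S (φ a) (φ b) = (b : Γ) * (a : Γ)⁻¹ := hlab
    rw [tileLabel_eq hD hσ hcomp] at hlab'
    simp only [ext, dif_pos (hu a a.2), dif_pos (hu b b.2)]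
    rw [hcomp ⟨_, hu a a.2⟩ ⟨_, hu b b.2⟩ (by simp [hlab'])]
  choose c₃ hc₃ using fun γ : {γ : Γ // γ ≠ 1} => exists_three_coloring γ.1 γ.2
  -- Outside `U` three fresh colors `n, n + 1, n + 2` are used, so there is no conflict with `U`;
  -- the palette of `n + 3` colors is within reach of `T` rounds.
  let c : {γ : Γ // γ ≠ 1} → Γ → ℕ := fun γ u =>
    if u ∈ U then ext (φ η₀) (u * (η₀ : Γ)⁻¹) else n + c₃ γ u
  have hextlt : ∀ u ∈ U, ext (φ η₀) (u * (η₀ : Γ)⁻¹) < n := by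
    intro u hu
    simp only [ext, dif_pos (hu η₀ η₀.2)]
    exact Fin.is_lt _
  have hc : ∀ γ u, c γ (γ * u) ≠ c γ u := by
    intro γ u
    simp only [c]
    split_ifs with h1 h2 h2
    · intro heq
      simp only [ext, dif_pos (h1 η₀ η₀.2), dif_pos (h2 η₀ η₀.2)] at heq
      have := (φ η₀).injective (Fin.ext heq)
      simp only [Subtype.mk.injEq, mul_left_inj] at this
      exact γ.2 (by simpa using this)
    · have := hextlt _ h1
      omega
    · have := hextlt _ h2
      omega
    · intro heq
      exact hc₃ γ u (Fin.ext (by omega))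
  have hclt : ∀ γ u, c γ u < 2 * halfPalette T := by
    intro γ u
    have h1 := tower_add_two_le_halfPalette T
    simp only [c]
    split_ifs with h
    · have := hextlt u h
      omega
    · have := (c₃ γ u).is_lt
      omega
  let y : ColoringSpace Γ := ⟨fun w => ⟨(colorReduction (w.1 : Γ))^[T] (c w.1) w.2,
    (iterate_colorReduction T (hc w.1) (hclt w.1)).2 w.2⟩, fun γ δ heq =>
    (iterate_colorReduction T (hc γ) (hclt γ)).1 δ (congrArg Fin.val heq)⟩
  refine hfP p hp ⟨y, fun η => ?_⟩
  rw [← hφp η, hF (φ η) ((η : Γ) • y)]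
  intro w hw
  rw [ColoringSpace.smul_apply]
  refine iterate_colorReduction_congr T fun a ha => ?_
  have hu : (w.1 : Γ) ^ a * (w.2 * η) ∈ U := fun η' hη' => by
    rw [← mul_assoc]
    exact hDW p hp w hw η η.2 η' hη' a ha
  simp only [c, if_pos hu]
  rw [← hU _ hu η]
  simp [mul_assoc]

/-- If `D = {1}` then `S ⊆ {1}` and connected patterns have one point, so any constant coloring by a
value of `f` works. -/
theorem tileGraph_hasAvoidingColoring_of_subset_one [Countable Γ] {k : ℕ}
    {P : Set (Pattern Γ k)} {S D : Finset Γ} (hPS : ∀ p ∈ P, p.SConnected S)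
    {f : ColoringSpace Γ → Fin k} (hfP : ∀ p ∈ P, ¬ p.Occurs f) {n : ℕ}
    (hD : S ∪ S⁻¹ ∪ {1} ⊆ D) (hD1 : D ⊆ {1}) : (tileGraph S D n hD).HasAvoidingColoring P := by
  choose c₃ hc₃ using fun γ : {γ : Γ // γ ≠ 1} => exists_three_coloring γ.1 γ.2
  let y : ColoringSpace Γ := ⟨fun w => Fin.castLE (by norm_num) (c₃ w.1 w.2), fun γ δ heq =>
    hc₃ γ δ (Fin.castLE_injective _ heq)⟩
  refine ⟨fun _ => f y, fun p hp ⟨φ, _, hφp⟩ => ?_⟩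
  obtain ⟨η₀⟩ := (hPS p hp).nonempty
  refine hfP p hp ⟨(η₀ : Γ)⁻¹ • y, fun η => ?_⟩
  have : (η : Γ) = η₀ := by
    refine (hPS p hp).eq_of_forall_adj (fun η : p.dom => (η : Γ)) ?_ η η₀
    rintro a b ⟨-, σ, hσ, hab⟩
    have h1 := hD1 (hD (Finset.mem_union_left _ hσ))
    rw [Finset.mem_singleton.1 h1, one_mul] at hab
    exact hab.symm
  rw [this, smul_inv_smul]
  exact hφp η

theorem eventually_tileGraph_hasAvoidingColoring [Countable Γ] {k : ℕ} (hk : 1 ≤ k)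
    {P : Set (Pattern Γ k)} (hP : P.Finite) {S : Finset Γ} (hPS : ∀ p ∈ P, p.SConnected S)
    (h : HasContinuousAvoidingColoring P (ColoringSpace Γ)) {F : ℕ → Finset Γ} {n : ℕ → ℕ}
    (hFn : IsTileSequence S F n) :
    {i | ¬ (tileGraph S (F i ^ logStar (n i)) (n i) (hFn.subset i)).HasAvoidingColoring P}.Finite := by
  obtain ⟨f, hf, hfP⟩ := h
  obtain ⟨W, hW⟩ := ColoringSpace.exists_window hf
  have hmem : ∀ γ : Γ, ∀ᶠ i in Filter.atTop, γ ∈ F i := by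
    intro γ
    obtain ⟨i, hi⟩ := hFn.exhausts γ
    filter_upwards [Filter.eventually_ge_atTop i] with j hj using hFn.strictMono.monotone hj hi
  have hev : ∀ᶠ i in Filter.atTop, ∀ p ∈ P, ∀ w ∈ W, ∀ η ∈ p.dom, ∀ η' ∈ p.dom,
      w.2 * η * η'⁻¹ ∈ F i ∧ (w.1 : Γ) * w.2 * η * η'⁻¹ ∈ F i ∧ (w.1 : Γ) ∈ F i :=
    (Filter.eventually_all_finite hP).2 fun p _ => (Filter.eventually_all_finset W).2 fun w _ =>
      (Filter.eventually_all_finset _).2 fun η _ => (Filter.eventually_all_finset _).2 fun η' _ =>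
        (hmem _).and ((hmem _).and (hmem _))
  rw [← Nat.cofinite_eq_atTop] at hev
  refine Set.Finite.subset (Filter.eventually_cofinite.1 hev) fun i hi hev => hi ?_
  have h1 : (1 : Γ) ∈ F i := hFn.strictMono.monotone (Nat.zero_le i) (hFn.base (by simp))
  -- Here `F i ^ 0 = {1}` need not contain `F i`, so this degenerate case is separate.
  by_cases hT : logStar (n i) = 0
  · exact tileGraph_hasAvoidingColoring_of_subset_one hPS hfP _ (by rw [hT, pow_zero]; rfl)
  refine tileGraph_hasAvoidingColoring_of_window hk hPS hfP hW _ (le_tower_logStar (n i)) ?_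
  intro p hp w hw η hη η' hη' a ha
  obtain ⟨h2, h3, h4⟩ := hev p hp w hw η hη η' hη'
  cases a with
  | zero =>
    rw [pow_zero, one_mul]
    exact Finset.subset_pow h1 hT h2
  | succ a =>
    -- One factor `γ` is absorbed into the last element of `F i`; thus the `T + 1` points read in
    -- `T` rounds fit into `F i ^ T`.
    have h5 : (w.1 : Γ) ^ (a + 1) * w.2 * η * η'⁻¹ = (w.1 : Γ) ^ a * (w.1 * w.2 * η * η'⁻¹) := by
      rw [pow_succ]; group
    rw [h5]
    refine Finset.pow_subset_pow_right h1 ha ?_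
    rw [pow_succ]
    exact Finset.mul_mem_mul (Finset.pow_mem_pow h4) h3

end TilesOfSpaces

end ContinuousColoring

/-! ### The cycle of implications -/

theorem theorem1p9 {Γ : Type u} [Group Γ] [DecidableEq Γ] [Countable Γ] [Infinite Γ]
    (S : Finset Γ) :
    (∃ (F : ℕ → Finset Γ) (n : ℕ → ℕ), ContinuousColoring.IsTileSequence S F n) ∧
    ∀ (F : ℕ → Finset Γ) (n : ℕ → ℕ) (hFn : ContinuousColoring.IsTileSequence S F n)
      (k : ℕ) (_ : 1 ≤ k) (P : Set (ContinuousColoring.Pattern Γ k)) (_ : P.Finite)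
      (_ : ∀ p ∈ P, p.SConnected S),
      List.TFAE [
        ContinuousColoring.HasContinuousAvoidingColoring P
          (ContinuousColoring.FreePart Γ (ContinuousColoring.Shift Γ 2)),
        ∀ (X : Type u) [TopologicalSpace X] [PolishSpace X] [MulAction Γ X]
          [ContinuousConstSMul Γ X],
          ContinuousColoring.ZeroDimensional X → ContinuousColoring.FreeAction Γ X →
            ContinuousColoring.HasContinuousAvoidingColoring P X,
        ∃ i, (ContinuousColoring.tileGraph S (F i ^ ContinuousColoring.logStar (n i)) (n i)
          (hFn.subset i)).HasAvoidingColoring P,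
        {i | ¬ (ContinuousColoring.tileGraph S (F i ^ ContinuousColoring.logStar (n i)) (n i)
          (hFn.subset i)).HasAvoidingColoring P}.Finite] := by
  refine ⟨ContinuousColoring.exists_isTileSequence S, fun F n hFn k hk P hP hPS => ?_⟩
  tfae_have 1 → 2 := fun h X _ _ _ _ hX hfree =>
    ContinuousColoring.hasContinuousAvoidingColoring_of_freePart hk hP h X hX hfree
  tfae_have 2 → 4 := fun h =>
    ContinuousColoring.eventually_tileGraph_hasAvoidingColoring hk hP hPS
      (h (ContinuousColoring.ColoringSpace Γ) ContinuousColoring.ColoringSpace.zeroDimensional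
        ContinuousColoring.ColoringSpace.freeAction) hFn
  tfae_have 4 → 3 := fun h => by
    obtain ⟨i, hi⟩ := h.exists_notMem
    exact ⟨i, not_not.1 hi⟩
  tfae_have 3 → 1 := fun ⟨i, hi⟩ =>
    ContinuousColoring.hasContinuousAvoidingColoring_of_tileGraph (hFn.subset i) (by
      refine le_trans (Nat.pow_le_pow_left Finset.card_pow_le 2) ?_
      rw [← pow_mul, mul_comm]
      exact hFn.card_pow_le i) hi _
      (ContinuousColoring.zeroDimensional_freePart_shift 2)
      (ContinuousColoring.freeAction_freePart _)
  tfae_finish
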